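/- Let $X_{n,k}$ ($n\ge 1$, $0<k<2^n$, $k$ odd) be independent random variables, uniformly distributed on $[0,1]$, on some probability space. Define a random function $\varphi$ on the dyadic rationals of $[0,1]$ by $\varphi(0)=0$, $\varphi(1)=1$ and, inductively in $n$, $$\varphi(k2^{-n})=\varphi((k-1)2^{-n})+X_{n,k}\cdot\bigl(\varphi((k+1)2^{-n})-\varphi((k-1)2^{-n})\bigr)\qquad(k\text{ odd},\ 0<k<2^n).$$ With probability $1$ it extends (uniquely) to a homeomorphism $\varphi$ of $[0,1]$, the Dubins--Freedman random homeomorphism with base measure uniform on $\{x=\frac12\}$. Let $\mathbb T=\mathbb R/\mathbb Z$ be the circle, identified with $[0,1]$ with its endpoints glued, and for continuous $f:\mathbb T\to\mathbb R$ let $\omega_f(\delta)=\sup_{|x-y|\le\delta}|f(x)-f(y)|$, where $|x-y|$ is the distance on $\mathbb T$. Theorem. There exists a continuous function $f:\mathbb T\to\mathbb R$ with $$|f(\delta)-f(0)|=O\Bigl(\bigl(\log\log\log\tfrac1{|\delta|}\bigr)^{-1}\Bigr)\quad(\delta\to0),$$ and even $$\omega_f(\delta)=O\Bigl(\bigl(\log\log\log\tfrac1\delta\bigr)^{-1}\Bigr)\quad(\delta\to0^+),$$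 such that, with probability $1$, the Fourier series of $f\circ\varphi$ diverges at $0$; that is, the symmetric partial sums $$S_n(f\circ\varphi;0)=\sum_{|j|\le n}\int_0^1 f(\varphi(t))e^{-2\pi i jt}\,dt$$ do not converge to any limit as $n\to\infty$. (The function $f$ does not depend on the probability space or on the choice of the $X_{n,k}$.) -/

import Mathlib

open Filter Topology MeasureTheory ProbabilityTheory

/-- Indices `(n, k)` with `k` odd and `0 < k < 2 ^ n` (so `1 ≤ n`); they enumerate the dyadic
rationals `k 2⁻ⁿ` of `(0, 1)` in lowest terms. -/
abbrev DyadicIndex : Type := {p : ℕ × ℕ // Odd p.2 ∧ p.2 < 2 ^ p.1}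

/-- The value prescribed at `k 2⁻ⁿ` by the parameters `U`: it is `0` at `0`, `1` at `1`, and at a
new dyadic point `k 2⁻ⁿ` (`k` odd)
`φ(k2⁻ⁿ) = φ((k-1)2⁻ⁿ) + U (n, k) * (φ((k+1)2⁻ⁿ) - φ((k-1)2⁻ⁿ))`. Only `k ≤ 2 ^ n` matters. -/
noncomputable def dyadicValue (U : DyadicIndex → ℝ) : ℕ → ℕ → ℝ
  | 0, k => k
  | n + 1, k =>
    if h : Odd k ∧ k < 2 ^ (n + 1) then
      dyadicValue U n ((k - 1) / 2) +
        U ⟨(n + 1, k), h⟩ * (dyadicValue U n ((k + 1) / 2) - dyadicValue U n ((k - 1) / 2))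
    else dyadicValue U n (k / 2)

/-- The homeomorphism `φ` of `[0, 1]` takes the values prescribed by `U` at all dyadic rationals.
By density there is at most one such `φ`. -/
def ExtendsDyadic (U : DyadicIndex → ℝ) (φ : unitInterval ≃ₜ unitInterval) : Prop :=
  ∀ (n k : ℕ) (t : unitInterval), (t : ℝ) = (k : ℝ) / 2 ^ n → (φ t : ℝ) = dyadicValue U n k

/-- The function `f ∘ φ` on the circle `ℝ / ℤ`, which is identified with `[0, 1)`. -/
noncomputable def compHomeo (f : C(UnitAddCircle, ℝ)) (φ : unitInterval ≃ₜ unitInterval) :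
    UnitAddCircle → ℂ :=
  AddCircle.liftIco 1 0 fun x : ℝ =>
    ((f (((φ (Set.projIcc 0 1 zero_le_one x) : unitInterval) : ℝ) : UnitAddCircle) : ℝ) : ℂ)

/-- The `n`th symmetric partial sum at `x` of the Fourier series of `g`. -/
noncomputable def fourierPartialSum (g : UnitAddCircle → ℂ) (n : ℕ) (x : UnitAddCircle) : ℂ :=
  ∑ j ∈ Finset.Icc (-(n : ℤ)) (n : ℤ), fourierCoeff g j * fourier j x

/-- The modulus of continuity `sup {|f x - f y| : |x - y| ≤ δ}`, with the distance of the circle. -/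
noncomputable def modulusOfContinuity (f : C(UnitAddCircle, ℝ)) (δ : ℝ) : ℝ :=
  sSup {d : ℝ | ∃ x y : UnitAddCircle, dist x y ≤ δ ∧ d = |f x - f y|}

/-!
The function is a sum `bumpSum` of bumps with disjoint supports that accumulate only at `0`. The `k`th
bump oscillates at one frequency on `M = octaves k ~ log log k` octaves below `scale k`, with height
`1 / M`. As `scale k = 2 ^ (-(k + 1) ^ 4)`, the number `M` is of order `log log log (1 / scale k)`,
which gives the modulus of continuity (`modulusOfContinuity_circleBump_isBigO`).

If the random homeomorphism `φ` were linear near the `k`th support, the composition would be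
`sin (2 π n t) / M` on `M` octaves of `t` for some `n`, and its integral against the Dirichlet kernel
of order `n`, which behaves like `sin (2 π n t) / (π t)`, would be at least an absolute constant
(`integral_bumpAt_linear_ge`). Nearly linear behaviour on a fine enough grid is a condition on
`2 ^ O(M)` parameters, and has a probability of at least `1 / k` (`IsFavourable`,
`eventually_one_div_le_favourableProb`). To have attempts that do not influence each other, let
`2 ^ (-m)` be the first of the points `2 ^ (-i)` at which `φ` is at most `2 * scale k`. Given the
parameters of lower levels, the value there is uniform below this threshold and the parameters of
higher levels are independent of it, so that the attempt of index `k` succeeds with probability at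
least `1 / k` whatever happened before (`measure_inter_isFavourable_ge`). Hence almost surely there
are infinitely many successes (`ae_frequently_isFavourable`).

The other bumps do not matter. Those of larger index are confined to smaller `t`, below the resolution
of the kernel. For those of smaller index only the total variation counts, which composition with a
monotone function preserves: the integrated Dirichlet kernel of order `n` is `O(1 / (n u))` on
`[u, 1 / 2]`, and there are at least `k` dyadic levels between the supports
(`abs_integral_bump_comp_mul_dirichletKernel_le`, `eventually_spine_decay`). The same two estimates
show that at the orders `2 ^ m`, below the frequency of the `k`th bump, the partial sums tend to `0`.
So they have no limit (`not_tendsto_integral_bumpSum`).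

The gaps between consecutive values of level `n` have second moment `3 ^ (-n)` (`lintegral_gap_sq`),
which gives both the existence of `φ` and the decay of `φ (2 ^ (-m))`.
-/

/-! ### The Dirichlet kernel -/

/-- The Dirichlet kernel `∑_{|j| ≤ n} cos (2 π j t)` of the circle of length `1`. -/
noncomputable def dirichletKernel (n : ℕ) (t : ℝ) : ℝ :=
  ∑ j ∈ Finset.Icc (-(n : ℤ)) n, Real.cos (2 * Real.pi * j * t)

@[fun_prop]
lemma continuous_dirichletKernel (n : ℕ) : Continuous (dirichletKernel n) := by
  unfold dirichletKernel
  fun_prop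

lemma abs_dirichletKernel_le (n : ℕ) (t : ℝ) : |dirichletKernel n t| ≤ 2 * n + 1 := by
  refine (Finset.abs_sum_le_sum_abs _ _).trans ?_
  refine (Finset.sum_le_sum fun j _ => Real.abs_cos_le_one _).trans ?_
  simp only [Finset.sum_const, Int.card_Icc, nsmul_eq_mul, mul_one]
  have : ((n : ℤ) + 1 - -(n : ℤ)).toNat = 2 * n + 1 := by omega
  rw [this]
  push_cast
  rfl

lemma dirichletKernel_succ (n : ℕ) (t : ℝ) :
    dirichletKernel (n + 1) t =
      dirichletKernel n t + 2 * Real.cos (2 * Real.pi * (n + 1) * t) := by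
  have h : Finset.Icc (-((n + 1 : ℕ) : ℤ)) ((n + 1 : ℕ) : ℤ) =
      insert (-((n : ℤ) + 1)) (insert ((n : ℤ) + 1) (Finset.Icc (-(n : ℤ)) n)) := by
    ext j
    simp only [Finset.mem_Icc, Finset.mem_insert]
    omega
  unfold dirichletKernel
  rw [h, Finset.sum_insert, Finset.sum_insert]
  · have : Real.cos (2 * Real.pi * ((-((n : ℤ) + 1) : ℤ) : ℝ) * t) =
        Real.cos (2 * Real.pi * (n + 1) * t) := by
      rw [← Real.cos_neg]
      congr 1
      push_cast
      ring
    rw [this]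
    push_cast
    ring
  · simp
  · simp only [Finset.mem_Icc, Finset.mem_insert]
    omega

lemma dirichletKernel_mul_sin (n : ℕ) (t : ℝ) :
    dirichletKernel n t * Real.sin (Real.pi * t) = Real.sin ((2 * n + 1) * (Real.pi * t)) := by
  induction n with
  | zero => simp [dirichletKernel]
  | succ n ih =>
    rw [dirichletKernel_succ, add_mul, ih]
    have h1 : ((2 * ((n + 1 : ℕ) : ℝ) + 1) * (Real.pi * t)) =
        2 * Real.pi * (n + 1) * t + Real.pi * t := by push_cast; ring
    have h2 : ((2 * (n : ℝ) + 1) * (Real.pi * t)) =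
        2 * Real.pi * (n + 1) * t - Real.pi * t := by ring
    rw [h1, h2, Real.sin_add, Real.sin_sub]
    ring

lemma dirichletKernel_one_sub (n : ℕ) (t : ℝ) :
    dirichletKernel n (1 - t) = dirichletKernel n t := by
  unfold dirichletKernel
  refine Finset.sum_congr rfl fun j _ => ?_
  have : 2 * Real.pi * j * (1 - t) = (j : ℝ) * (2 * Real.pi) - 2 * Real.pi * j * t := by ring
  rw [this, Real.cos_int_mul_two_pi_sub]

/-- Integration by parts against the monotone weight `1 / sin (π s)`: the integrated Dirichlet
kernel decays like `1 / (n u)`. -/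
lemma abs_integral_dirichletKernel_le_of_le_half (n : ℕ) {u : ℝ} (hu : 0 < u) (hu' : u ≤ 1 / 2) :
    |∫ s in u..(1 / 2), dirichletKernel n s| ≤ (2 * n + 1 : ℝ)⁻¹ * u⁻¹ := by
  have hpi := Real.pi_pos
  have hN : (0 : ℝ) < 2 * n + 1 := by positivity
  have hsin : ∀ s ∈ Set.uIcc u (1 / 2), 0 < Real.sin (Real.pi * s) := by
    intro s hs
    rw [Set.uIcc_of_le hu'] at hs
    apply Real.sin_pos_of_pos_of_lt_pi
    · exact mul_pos hpi (hu.trans_le hs.1)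
    · nlinarith [hs.2]
  set V : ℝ → ℝ := fun s => -(Real.cos ((2 * n + 1) * (Real.pi * s)) / ((2 * n + 1) * Real.pi))
    with hV
  set w : ℝ → ℝ := fun s => (Real.sin (Real.pi * s))⁻¹ with hw
  set w' : ℝ → ℝ := fun s => -(Real.cos (Real.pi * s) * Real.pi) / Real.sin (Real.pi * s) ^ 2
    with hw'
  have hVd : ∀ s ∈ Set.uIcc u (1 / 2), HasDerivAt V (Real.sin ((2 * n + 1) * (Real.pi * s))) s := by
    intro s _
    have h1 : HasDerivAt (fun s : ℝ => (2 * (n : ℝ) + 1) * (Real.pi * s))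
        ((2 * n + 1) * Real.pi) s := by
      simpa using ((hasDerivAt_id s).const_mul Real.pi).const_mul (2 * (n : ℝ) + 1)
    refine HasDerivAt.congr_deriv (h1.cos.div_const ((2 * n + 1) * Real.pi)).neg ?_
    field_simp
  have hwd : ∀ s ∈ Set.uIcc u (1 / 2), HasDerivAt w (w' s) s := by
    intro s hs
    have h1 : HasDerivAt (fun s : ℝ => Real.pi * s) Real.pi s := by
      simpa using (hasDerivAt_id s).const_mul Real.pi
    exact h1.sin.inv (hsin s hs).ne'
  have hw'c : ContinuousOn w' (Set.uIcc u (1 / 2)) := by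
    apply ContinuousOn.div (by fun_prop) (by fun_prop)
    intro s hs
    exact pow_ne_zero _ (hsin s hs).ne'
  have hw'i : IntervalIntegrable w' volume u (1 / 2) := hw'c.intervalIntegrable
  have hparts := intervalIntegral.integral_mul_deriv_eq_deriv_mul hwd hVd hw'i
    ((by fun_prop : Continuous fun s : ℝ =>
      Real.sin ((2 * n + 1) * (Real.pi * s))).intervalIntegrable _ _)
  have hD : ∫ s in u..(1 / 2), dirichletKernel n s =
      ∫ s in u..(1 / 2), w s * Real.sin ((2 * n + 1) * (Real.pi * s)) := by
    apply intervalIntegral.integral_congr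
    intro s hs
    have := (hsin s hs).ne'
    simp only [hw]
    rw [← dirichletKernel_mul_sin]
    field_simp
  have hVhalf : V (1 / 2) = 0 := by
    simp only [hV, neg_eq_zero, div_eq_zero_iff]
    left
    rw [Real.cos_eq_zero_iff]
    exact ⟨n, by push_cast; ring⟩
  have hVb : ∀ s, |V s| ≤ ((2 * n + 1) * Real.pi)⁻¹ := by
    intro s
    simp only [hV, abs_neg, abs_div]
    rw [abs_of_pos (by positivity : (0 : ℝ) < (2 * n + 1) * Real.pi), div_eq_mul_inv]
    exact mul_le_of_le_one_left (by positivity) (Real.abs_cos_le_one _)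
  have hint : ∫ s in u..(1 / 2), w' s = w (1 / 2) - w u :=
    intervalIntegral.integral_eq_sub_of_hasDerivAt hwd hw'i
  have hwhalf : w (1 / 2) = 1 := by
    simp only [hw]
    rw [show Real.pi * (1 / 2) = Real.pi / 2 by ring, Real.sin_pi_div_two, inv_one]
  have hw'V : |∫ s in u..(1 / 2), w' s * V s| ≤ ((2 * n + 1) * Real.pi)⁻¹ * (w u - 1) := by
    have : ((2 * n + 1) * Real.pi)⁻¹ * (w u - 1) =
        ∫ s in u..(1 / 2), ((2 * n + 1) * Real.pi)⁻¹ * (-w' s) := by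
      rw [intervalIntegral.integral_const_mul, intervalIntegral.integral_neg, hint, hwhalf]
      ring
    rw [this, ← Real.norm_eq_abs]
    apply intervalIntegral.norm_integral_le_of_norm_le hu'
    · refine Filter.Eventually.of_forall fun s hs => ?_
      have hs' : s ∈ Set.uIcc u (1 / 2) := by
        rw [Set.uIcc_of_le hu']; exact Set.Ioc_subset_Icc_self hs
      have hcos : 0 ≤ Real.cos (Real.pi * s) := by
        apply Real.cos_nonneg_of_neg_pi_div_two_le_of_le
        · have := hu.trans hs.1; nlinarith
        · nlinarith [hs.2]
      have hneg : w' s ≤ 0 := by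
        simp only [hw']
        apply div_nonpos_of_nonpos_of_nonneg
        · have := mul_nonneg hcos hpi.le; linarith
        · positivity
      rw [norm_mul, Real.norm_eq_abs, Real.norm_eq_abs, abs_of_nonpos hneg, mul_comm]
      exact mul_le_mul_of_nonneg_right (hVb s) (by linarith)
    · exact (hw'i.neg).const_mul _
  have hsinu : 2 * u ≤ Real.sin (Real.pi * u) := by
    have := Real.mul_le_sin (x := Real.pi * u) (by positivity) (by nlinarith)
    have h2 : 2 / Real.pi * (Real.pi * u) = 2 * u := by field_simp
    linarith
  have hwu : w u ≤ (2 * u)⁻¹ := inv_anti₀ (by positivity) hsinu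
  have hwu0 : 0 ≤ w u := inv_nonneg.2 (by linarith)
  rw [hD, hparts, hVhalf, mul_zero, zero_sub]
  have hA : |w u * V u| ≤ ((2 * n + 1) * Real.pi)⁻¹ * w u := by
    rw [abs_mul, abs_of_nonneg hwu0, mul_comm]
    exact mul_le_mul_of_nonneg_right (hVb u) hwu0
  have hle : ((2 * (n : ℝ) + 1) * Real.pi)⁻¹ ≤ (2 * n + 1 : ℝ)⁻¹ := by
    apply inv_anti₀ hN
    nlinarith [Real.pi_gt_three]
  have h3 := abs_sub (-(w u * V u)) (∫ s in u..(1 / 2), w' s * V s)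
  rw [abs_neg] at h3
  have hpos : 0 < ((2 * (n : ℝ) + 1) * Real.pi)⁻¹ := by positivity
  calc |-(w u * V u) - ∫ s in u..(1 / 2), w' s * V s|
      ≤ ((2 * n + 1) * Real.pi)⁻¹ * (2 * w u) := by linarith
    _ ≤ ((2 * n + 1) * Real.pi)⁻¹ * u⁻¹ := by
        apply mul_le_mul_of_nonneg_left _ hpos.le
        have : (2 * u)⁻¹ = u⁻¹ / 2 := by field_simp
        linarith
    _ ≤ _ := mul_le_mul_of_nonneg_right hle (by positivity)

lemma abs_integral_dirichletKernel_le (n : ℕ) {u : ℝ} (hu : 0 < u) (hu' : u < 1) :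
    |∫ s in u..(1 / 2), dirichletKernel n s| ≤ (2 * n + 1 : ℝ)⁻¹ * (u⁻¹ + (1 - u)⁻¹) := by
  have h1 : 0 < (1 - u)⁻¹ := inv_pos.2 (by linarith)
  have h2 : 0 < u⁻¹ := inv_pos.2 hu
  have hN : (0 : ℝ) < (2 * n + 1 : ℝ)⁻¹ := by positivity
  rcases le_total u (1 / 2) with h | h
  · refine (abs_integral_dirichletKernel_le_of_le_half n hu h).trans ?_
    nlinarith [mul_pos hN h1]
  · have := abs_integral_dirichletKernel_le_of_le_half n (u := 1 - u) (by linarith) (by linarith)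
    have h3 : ∫ s in (1 - u)..(1 / 2), dirichletKernel n s =
        -∫ s in u..(1 / 2), dirichletKernel n s := by
      rw [← intervalIntegral.integral_symm]
      have h4 := intervalIntegral.integral_comp_sub_left (a := 1 / 2) (b := u)
        (dirichletKernel n) 1
      simp only [dirichletKernel_one_sub] at h4
      rw [h4]
      norm_num
    rw [h3, abs_neg] at this
    nlinarith [mul_pos hN h2]

lemma dirichletKernel_mul_sin_ge (n : ℕ) {t : ℝ} (ht : 0 < t) (ht' : t ≤ 1 / 4) :
    Real.sin (2 * Real.pi * n * t) ^ 2 / (2 * Real.pi * t) - 1 ≤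
      Real.sin (2 * Real.pi * n * t) * dirichletKernel n t := by
  have hpi := Real.pi_pos
  have hx : 0 < Real.pi * t := by positivity
  have hs : 0 < Real.sin (Real.pi * t) :=
    Real.sin_pos_of_pos_of_lt_pi hx (by nlinarith)
  have hs' : Real.sin (Real.pi * t) ≤ Real.pi * t := Real.sin_le hx.le
  have hc : 1 / 2 ≤ Real.cos (Real.pi * t) := by
    rw [← Real.cos_pi_div_three]
    apply Real.cos_le_cos_of_nonneg_of_le_pi hx.le (by linarith) (by nlinarith)
  have hD := dirichletKernel_mul_sin n t
  have he : (2 * (n : ℝ) + 1) * (Real.pi * t) = 2 * Real.pi * n * t + Real.pi * t := by ring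
  rw [he, Real.sin_add] at hD
  set S := Real.sin (2 * Real.pi * n * t)
  set C := Real.cos (2 * Real.pi * n * t)
  have hSC : S ^ 2 + C ^ 2 = 1 := Real.sin_sq_add_cos_sq _
  have hD' : dirichletKernel n t =
      S * (Real.cos (Real.pi * t) / Real.sin (Real.pi * t)) + C := by
    field_simp
    linarith
  have hcot : 1 / (2 * Real.pi * t) ≤ Real.cos (Real.pi * t) / Real.sin (Real.pi * t) := by
    rw [div_le_div_iff₀ (by positivity) hs]
    nlinarith
  rw [hD']
  have := mul_le_mul_of_nonneg_left hcot (sq_nonneg S)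
  have h4 : S ^ 2 / (2 * Real.pi * t) = S ^ 2 * (1 / (2 * Real.pi * t)) := by ring
  rw [h4]
  nlinarith [sq_nonneg (S + C)]

/-- The resonance between `sin (2 π n t)` and the Dirichlet kernel on one octave `[α, 2 α]`. -/
lemma integral_sin_mul_dirichletKernel_octave (n q : ℕ) {α : ℝ} (hα : 0 < α) (hα' : α ≤ 1 / 8)
    (hq : 0 < q) (hn : (n : ℝ) * α = q) :
    1 / (8 * Real.pi) - α ≤
      ∫ t in α..(2 * α), Real.sin (2 * Real.pi * n * t) * dirichletKernel n t := by
  have hpi := Real.pi_pos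
  have hsq : ∫ t in α..(2 * α), Real.sin (2 * Real.pi * n * t) ^ 2 = α / 2 := by
    have hn0 : (0 : ℝ) < n := by
      have : (0 : ℝ) < q := by exact_mod_cast hq
      by_contra h
      nlinarith
    have h := intervalIntegral.integral_comp_mul_left (a := α) (b := 2 * α)
      (fun x => Real.sin x ^ 2) (c := 2 * Real.pi * n) (by positivity)
    rw [h, integral_sin_sq]
    have e1 : 2 * Real.pi * n * α = (2 * q : ℕ) * Real.pi := by
      push_cast; rw [← hn]; ring
    have e2 : 2 * Real.pi * n * (2 * α) = (4 * q : ℕ) * Real.pi := by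
      push_cast; rw [← hn]; ring
    rw [e1, e2, Real.sin_nat_mul_pi, Real.sin_nat_mul_pi, ← e1, ← e2, smul_eq_mul]
    field_simp
    ring
  have hc : Continuous fun t : ℝ => Real.sin (2 * Real.pi * n * t) * dirichletKernel n t :=
    (by fun_prop : Continuous fun t : ℝ => Real.sin (2 * Real.pi * n * t)).mul
      (continuous_dirichletKernel n)
  calc 1 / (8 * Real.pi) - α
      = ∫ t in α..(2 * α), (Real.sin (2 * Real.pi * n * t) ^ 2 * (4 * Real.pi * α)⁻¹ - 1) := by
        rw [intervalIntegral.integral_sub, intervalIntegral.integral_mul_const, hsq]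
        · simp only [intervalIntegral.integral_const, smul_eq_mul, mul_one]
          field_simp
          ring
        · exact (by fun_prop : Continuous fun t : ℝ =>
            Real.sin (2 * Real.pi * n * t) ^ 2 * (4 * Real.pi * α)⁻¹).intervalIntegrable _ _
        · exact intervalIntegrable_const
    _ ≤ _ := by
        apply intervalIntegral.integral_mono_on (by linarith)
        · exact (by fun_prop : Continuous fun t : ℝ =>
            Real.sin (2 * Real.pi * n * t) ^ 2 * (4 * Real.pi * α)⁻¹ - 1).intervalIntegrable _ _
        · exact hc.intervalIntegrable _ _
        · intro t ht
          have ht0 : 0 < t := hα.trans_le ht.1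
          refine le_trans ?_ (dirichletKernel_mul_sin_ge n ht0 (by linarith [ht.2]))
          rw [div_eq_mul_inv]
          have : (4 * Real.pi * α)⁻¹ ≤ (2 * Real.pi * t)⁻¹ := by
            apply inv_anti₀ (by positivity)
            nlinarith [ht.2]
          nlinarith [mul_le_mul_of_nonneg_left this (sq_nonneg (Real.sin (2 * Real.pi * n * t)))]

/-- Each of the `M` octaves of `[2 ^ (-p - M), 2 ^ (-p)]` contributes the same amount. -/
lemma integral_sin_mul_dirichletKernel_ge (p M : ℕ) (hp : 2 ≤ p) :
    (M : ℝ) / (8 * Real.pi) - 1 ≤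
      ∫ t in ((1 / 2 : ℝ) ^ (p + M))..((1 / 2 : ℝ) ^ p),
        Real.sin (2 * Real.pi * (2 ^ (p + M) : ℕ) * t) * dirichletKernel (2 ^ (p + M)) t := by
  have hc : Continuous fun t : ℝ => Real.sin (2 * Real.pi * (2 ^ (p + M) : ℕ) * t) *
      dirichletKernel (2 ^ (p + M)) t :=
    (by fun_prop : Continuous fun t : ℝ => Real.sin (2 * Real.pi * (2 ^ (p + M) : ℕ) * t)).mul
      (continuous_dirichletKernel _)
  have key : ∀ i ≤ M, (i : ℝ) / (8 * Real.pi) - ((1 / 2 : ℝ) ^ p - (1 / 2 : ℝ) ^ (p + i)) ≤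
      ∫ t in ((1 / 2 : ℝ) ^ (p + i))..((1 / 2 : ℝ) ^ p),
        Real.sin (2 * Real.pi * (2 ^ (p + M) : ℕ) * t) * dirichletKernel (2 ^ (p + M)) t := by
    intro i
    induction i with
    | zero => simp
    | succ i ih =>
      intro hi
      have hle : (1 / 2 : ℝ) ^ (p + (i + 1)) ≤ 1 / 8 := by
        calc (1 / 2 : ℝ) ^ (p + (i + 1)) ≤ (1 / 2 : ℝ) ^ 3 :=
              pow_le_pow_of_le_one (by norm_num) (by norm_num) (by omega)
          _ = 1 / 8 := by norm_num
      have h2 : 2 * (1 / 2 : ℝ) ^ (p + (i + 1)) = (1 / 2 : ℝ) ^ (p + i) := by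
        rw [← add_assoc, pow_succ]; ring
      have hoct := integral_sin_mul_dirichletKernel_octave (2 ^ (p + M)) (2 ^ (M - (i + 1)))
        (α := (1 / 2 : ℝ) ^ (p + (i + 1))) (by positivity) hle (by positivity) (by
          obtain ⟨d, hd⟩ := Nat.exists_eq_add_of_le hi
          subst hd
          rw [Nat.add_sub_cancel_left]
          push_cast
          rw [one_div, inv_pow, ← add_assoc p, pow_add _ (p + (i + 1)) d]
          field_simp)
      rw [h2] at hoct
      rw [← intervalIntegral.integral_add_adjacent_intervals (hc.intervalIntegrable _ _)
        (hc.intervalIntegrable ((1 / 2 : ℝ) ^ (p + i)) _)]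
      have := ih (by omega)
      have h3 : ((i + 1 : ℕ) : ℝ) / (8 * Real.pi) = (i : ℝ) / (8 * Real.pi) + 1 / (8 * Real.pi) := by
        push_cast; ring
      linarith
  refine le_trans ?_ (key M le_rfl)
  have h1 : (1 / 2 : ℝ) ^ p ≤ 1 := pow_le_one₀ (by norm_num) (by norm_num)
  have h2 : (0 : ℝ) < (1 / 2 : ℝ) ^ (p + M) := by positivity
  linarith

/-! ### Oscillating bumps -/

/-- The function equal to `sin (2 π 2 ^ M x / b) / M` on `[b / 2 ^ M, b]` and to `0` elsewhere. The
truncation of the argument to that interval does this, as the sine vanishes at both ends. -/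
noncomputable def bump (b : ℝ) (M : ℕ) (x : ℝ) : ℝ :=
  Real.sin (2 * Real.pi * 2 ^ M / b * max (b / 2 ^ M) (min x b)) / M

section bump
variable {b : ℝ} {M : ℕ}

lemma div_two_pow_le (hb : 0 < b) : b / 2 ^ M ≤ b :=
  div_le_self hb.le (one_le_pow₀ (by norm_num))

lemma bump_of_mem {x : ℝ} (h1 : b / 2 ^ M ≤ x) (h2 : x ≤ b) :
    bump b M x = Real.sin (2 * Real.pi * 2 ^ M / b * x) / M := by
  rw [bump, min_eq_left h2, max_eq_right h1]

lemma bump_of_le (hb : 0 < b) {x : ℝ} (h : x ≤ b / 2 ^ M) : bump b M x = 0 := by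
  rw [bump, max_eq_left ((min_le_left _ _).trans h)]
  have : 2 * Real.pi * 2 ^ M / b * (b / 2 ^ M) = 2 * Real.pi := by field_simp
  rw [this, Real.sin_two_pi, zero_div]

lemma bump_of_ge (hb : 0 < b) {x : ℝ} (h : b ≤ x) : bump b M x = 0 := by
  rw [bump, min_eq_right h, max_eq_right (div_two_pow_le hb)]
  have : 2 * Real.pi * 2 ^ M / b * b = ((2 * 2 ^ M : ℕ) : ℝ) * Real.pi := by
    push_cast
    field_simp
  rw [this, Real.sin_nat_mul_pi, zero_div]

lemma abs_bump_le (b : ℝ) (M : ℕ) (x : ℝ) : |bump b M x| ≤ 1 / M := by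
  rw [bump, abs_div, Nat.abs_cast]
  exact div_le_div_of_nonneg_right (Real.abs_sin_le_one _) (Nat.cast_nonneg _)

lemma abs_bump_sub_le (hb : 0 < b) (hM : 1 ≤ M) (x y : ℝ) :
    |bump b M x - bump b M y| ≤ 7 * (b / 2 ^ M)⁻¹ * |x - y| := by
  have hM' : (1 : ℝ) ≤ M := by exact_mod_cast hM
  have hc : |max (b / 2 ^ M) (min x b) - max (b / 2 ^ M) (min y b)| ≤ |x - y| :=
    by
    refine (abs_max_sub_max_le_max _ _ _ _).trans (max_le (by simp) ?_)
    refine (abs_min_sub_min_le_max _ _ _ _).trans (max_le le_rfl (by simp))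
  rw [bump, bump, ← sub_div, abs_div, Nat.abs_cast]
  refine (div_le_self (abs_nonneg _) hM').trans ?_
  refine (Real.abs_sin_sub_sin_le _ _).trans ?_
  rw [← mul_sub, abs_mul, abs_of_pos (by positivity)]
  have h7 : 2 * Real.pi * 2 ^ M / b ≤ 7 * (b / 2 ^ M)⁻¹ := by
    rw [inv_div, mul_div_assoc]
    exact mul_le_mul_of_nonneg_right (by linarith [Real.pi_lt_d2]) (by positivity)
  exact mul_le_mul h7 hc (abs_nonneg _) (by positivity)

@[fun_prop]
lemma continuous_bump (b : ℝ) (M : ℕ) : Continuous (bump b M) := by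
  unfold bump
  fun_prop

/-- The derivative of `bump b M` inside its support. -/
noncomputable def bumpDeriv (b : ℝ) (M : ℕ) (x : ℝ) : ℝ :=
  2 * Real.pi * 2 ^ M / b / M * Real.cos (2 * Real.pi * 2 ^ M / b * x)

@[fun_prop]
lemma continuous_bumpDeriv (b : ℝ) (M : ℕ) : Continuous (bumpDeriv b M) := by
  unfold bumpDeriv
  fun_prop

lemma abs_bumpDeriv_le (hb : 0 < b) (hM : 1 ≤ M) (x : ℝ) :
    |bumpDeriv b M x| ≤ 7 * 2 ^ M / b := by
  have hM' : (1 : ℝ) ≤ M := by exact_mod_cast hM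
  rw [bumpDeriv, abs_mul, abs_of_pos (by positivity)]
  calc _ ≤ 2 * Real.pi * 2 ^ M / b / M * 1 :=
        mul_le_mul_of_nonneg_left (Real.abs_cos_le_one _) (by positivity)
    _ ≤ 2 * Real.pi * 2 ^ M / b := by
        rw [mul_one]
        exact div_le_self (by positivity) hM'
    _ ≤ _ := by
        apply div_le_div_of_nonneg_right _ hb.le
        exact mul_le_mul_of_nonneg_right (by linarith [Real.pi_lt_d2]) (by positivity)

lemma integral_bumpDeriv (hb : 0 < b) {y : ℝ} (h1 : b / 2 ^ M ≤ y) (h2 : y ≤ b) :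
    ∫ x in (b / 2 ^ M)..y, bumpDeriv b M x = bump b M y := by
  have hd : ∀ x ∈ Set.uIcc (b / 2 ^ M) y, HasDerivAt
      (fun x => Real.sin (2 * Real.pi * 2 ^ M / b * x) / M) (bumpDeriv b M x) x := by
    intro x _
    have h1 : HasDerivAt (fun x : ℝ => 2 * Real.pi * 2 ^ M / b * x) (2 * Real.pi * 2 ^ M / b) x := by
      simpa using (hasDerivAt_id x).const_mul (2 * Real.pi * 2 ^ M / b)
    refine (h1.sin.div_const (M : ℝ)).congr_deriv ?_
    unfold bumpDeriv
    ring
  rw [intervalIntegral.integral_eq_sub_of_hasDerivAt hd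
    ((continuous_bumpDeriv b M).intervalIntegrable _ _), ← bump_of_mem h1 h2,
    ← bump_of_mem le_rfl (div_two_pow_le hb), bump_of_le hb le_rfl, sub_zero]

lemma integral_bumpDeriv_eq_zero (hb : 0 < b) : ∫ x in (b / 2 ^ M)..b, bumpDeriv b M x = 0 := by
  rw [integral_bumpDeriv hb (div_two_pow_le hb) le_rfl, bump_of_ge hb le_rfl]

/-- The bump is recovered from its derivative by integrating over the points to the left. -/
lemma integral_indicator_bumpDeriv (hb : 0 < b) (y : ℝ) :
    ∫ x in (b / 2 ^ M)..b, (if x ≤ y then bumpDeriv b M x else 0) = bump b M y := by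
  have hab := div_two_pow_le (M := M) hb
  rcases le_total y (b / 2 ^ M) with h | h
  · rw [bump_of_le hb h, intervalIntegral.integral_of_le hab]
    rw [setIntegral_congr_fun (g := fun _ => (0 : ℝ)) measurableSet_Ioc]
    · simp
    · intro x hx
      exact if_neg (not_le.2 (h.trans_lt hx.1))
  rcases le_total b y with h' | h'
  · rw [bump_of_ge hb h', ← integral_bumpDeriv_eq_zero hb]
    apply intervalIntegral.integral_congr
    intro x hx
    rw [Set.uIcc_of_le hab] at hx
    exact if_pos (hx.2.trans h')
  · have hi : ∀ u v, IntervalIntegrable (fun x => if x ≤ y then bumpDeriv b M x else 0)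
        volume u v := by
      intro u v
      have := ((continuous_bumpDeriv b M).intervalIntegrable u v (μ := volume))
      rw [intervalIntegrable_iff] at this ⊢
      refine (this.indicator (measurableSet_Iic (a := y))).congr_fun (fun x _ => ?_)
        measurableSet_uIoc
      simp only [Set.indicator_apply, Set.mem_Iic]
    rw [← intervalIntegral.integral_add_adjacent_intervals (hi _ y) (hi y _)]
    have e1 : ∫ x in (b / 2 ^ M)..y, (if x ≤ y then bumpDeriv b M x else 0) = bump b M y := by
      rw [← integral_bumpDeriv hb h h']
      apply intervalIntegral.integral_congr
      intro x hx
      rw [Set.uIcc_of_le h] at hx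
      exact if_pos hx.2
    have e2 : ∫ x in y..b, (if x ≤ y then bumpDeriv b M x else 0) = 0 := by
      rw [intervalIntegral.integral_of_le h',
        setIntegral_congr_fun (g := fun _ => (0 : ℝ)) measurableSet_Ioc]
      · simp
      · intro x hx
        exact if_neg (not_le.2 hx.1)
    rw [e1, e2, add_zero]

/-- Against a bump composed with an increasing function, the Dirichlet kernel of high order is
small, with a bound that only uses the total variation of the bump: by Fubini's theorem the integral
is an average of `∫ t in ψ x..(1 / 2), dirichletKernel n t` against the derivative of the bump, where
`ψ` is the inverse function. -/
lemma abs_integral_bump_comp_mul_dirichletKernel_le (hb : 0 < b) (hM : 1 ≤ M) {g : ℝ → ℝ}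
    (hg : Continuous g) (hmono : StrictMonoOn g (Set.Icc 0 1)) {u v : ℝ} (hu : 0 < u)
    (hv : v < 1) (huv : u ≤ v) (hgu : g u ≤ b / 2 ^ M) (hgv : b ≤ g v) (n : ℕ) :
    |∫ t in (0 : ℝ)..1, bump b M (g t) * dirichletKernel n t| ≤
      7 * 2 ^ M * ((2 * n + 1 : ℝ)⁻¹ * (u⁻¹ + (1 - v)⁻¹)) := by
  have hab := div_two_pow_le (M := M) hb
  have hDc := continuous_dirichletKernel n
  set B : ℝ := (2 * n + 1 : ℝ)⁻¹ * (u⁻¹ + (1 - v)⁻¹) with hB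
  -- the inner integral, for a level `x` of the bump
  have hinner : ∀ x ∈ Set.Icc (b / 2 ^ M) b,
      |(∫ t in (0 : ℝ)..1, if x ≤ g t then dirichletKernel n t else 0) -
        ∫ t in (1 / 2 : ℝ)..1, dirichletKernel n t| ≤ B := by
    intro x hx
    obtain ⟨c, hc, hcx⟩ : x ∈ g '' Set.Icc u v :=
      intermediate_value_Icc huv hg.continuousOn ⟨hgu.trans hx.1, hx.2.trans hgv⟩
    have hc0 : 0 < c := hu.trans_le hc.1
    have hc1 : c < 1 := hc.2.trans_lt hv
    have hiff : ∀ t ∈ Set.Icc (0 : ℝ) 1, x ≤ g t ↔ c ≤ t := by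
      intro t ht
      rw [← hcx]
      exact hmono.le_iff_le ⟨hc0.le, hc1.le⟩ ht
    have hi1 : IntervalIntegrable (fun t => if x ≤ g t then dirichletKernel n t else 0)
        volume 0 c := by
      have := (hDc.intervalIntegrable 0 c (μ := volume))
      rw [intervalIntegrable_iff] at this ⊢
      refine (this.indicator (measurableSet_le measurable_const hg.measurable :
        MeasurableSet {t | x ≤ g t})).congr_fun (fun t _ => ?_) measurableSet_uIoc
      simp only [Set.indicator_apply, Set.mem_ofPred_eq]
    have e0 : ∫ t in (0 : ℝ)..c, (if x ≤ g t then dirichletKernel n t else 0) = 0 := by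
      rw [intervalIntegral.integral_of_le hc0.le, integral_Ioc_eq_integral_Ioo,
        setIntegral_congr_fun (g := fun _ => (0 : ℝ)) measurableSet_Ioo]
      · simp
      · intro t ht
        refine if_neg fun h => ?_
        exact absurd ((hiff t ⟨ht.1.le, (ht.2.trans hc1).le⟩).1 h) (not_le.2 ht.2)
    have e1 : ∀ t ∈ Set.uIcc c 1, (if x ≤ g t then dirichletKernel n t else 0) =
        dirichletKernel n t := by
      intro t ht
      rw [Set.uIcc_of_le hc1.le] at ht
      exact if_pos ((hiff t ⟨hc0.le.trans ht.1, ht.2⟩).2 ht.1)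
    have hi2 : IntervalIntegrable (fun t => if x ≤ g t then dirichletKernel n t else 0)
        volume c 1 := by
      have := (hDc.intervalIntegrable c 1 (μ := volume))
      rw [intervalIntegrable_iff] at this ⊢
      exact this.congr_fun (fun t ht => (e1 t (Set.uIoc_subset_uIcc ht)).symm) measurableSet_uIoc
    have hsplit := intervalIntegral.integral_add_adjacent_intervals (μ := volume)
      (hDc.intervalIntegrable c (1 / 2)) (hDc.intervalIntegrable (1 / 2) 1)
    rw [← intervalIntegral.integral_add_adjacent_intervals hi1 hi2, e0, zero_add,
      intervalIntegral.integral_congr e1, ← hsplit, add_sub_cancel_right]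
    refine (abs_integral_dirichletKernel_le n hc0 hc1).trans ?_
    refine mul_le_mul_of_nonneg_left (add_le_add ?_ ?_) (by positivity)
    · exact inv_anti₀ hu hc.1
    · exact inv_anti₀ (by linarith) (by linarith [hc.2])
  set G : ℝ → ℝ → ℝ := fun x t => bumpDeriv b M x * (if x ≤ g t then dirichletKernel n t else 0)
    with hG
  have hGint : Integrable (Function.uncurry G)
      ((volume.restrict (Set.Ioc (b / 2 ^ M) b)).prod (volume.restrict (Set.Ioc 0 1))) := by
    have hmeas : Measurable (Function.uncurry G) := by
      refine ((continuous_bumpDeriv b M).measurable.comp measurable_fst).mul ?_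
      exact Measurable.ite (measurableSet_le measurable_fst (hg.measurable.comp measurable_snd))
        (hDc.measurable.comp measurable_snd) measurable_const
    refine Integrable.of_bound hmeas.aestronglyMeasurable (7 * 2 ^ M / b * (2 * n + 1)) ?_
    refine Filter.Eventually.of_forall fun z => ?_
    simp only [Function.uncurry, hG]
    rw [norm_mul]
    refine mul_le_mul (abs_bumpDeriv_le hb hM _) ?_ (norm_nonneg _) (by positivity)
    split_ifs
    · exact abs_dirichletKernel_le n _
    · rw [norm_zero]; positivity
  have hswap : ∫ t in (0 : ℝ)..1, bump b M (g t) * dirichletKernel n t =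
      ∫ x in (b / 2 ^ M)..b, ∫ t in (0 : ℝ)..1, G x t := by
    rw [intervalIntegral_intervalIntegral_swap (by
      rwa [Set.uIoc_of_le hab, Set.uIoc_of_le zero_le_one, IntegrableOn, Measure.volume_eq_prod,
        ← Measure.prod_restrict])]
    apply intervalIntegral.integral_congr
    intro t _
    simp only [hG]
    rw [← integral_indicator_bumpDeriv hb, ← intervalIntegral.integral_mul_const]
    apply intervalIntegral.integral_congr
    intro x _
    simp only
    split_ifs <;> simp
  have hGi : IntervalIntegrable (fun x => ∫ t in (0 : ℝ)..1, G x t) volume (b / 2 ^ M) b := by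
    rw [intervalIntegrable_iff]
    have := hGint.integral_prod_left
    simpa only [Function.uncurry, IntegrableOn, intervalIntegral.integral_of_le zero_le_one,
      Set.uIoc_of_le hab] using this
  set I₀ : ℝ := ∫ t in (1 / 2 : ℝ)..1, dirichletKernel n t with hI₀
  have hsub : ∫ x in (b / 2 ^ M)..b, ∫ t in (0 : ℝ)..1, G x t =
      ∫ x in (b / 2 ^ M)..b, ((∫ t in (0 : ℝ)..1, G x t) - bumpDeriv b M x * I₀) := by
    rw [intervalIntegral.integral_sub hGi
      ((by fun_prop : Continuous fun x => bumpDeriv b M x * I₀).intervalIntegrable _ _),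
      intervalIntegral.integral_mul_const, integral_bumpDeriv_eq_zero hb, zero_mul, sub_zero]
  rw [hswap, hsub, ← Real.norm_eq_abs]
  have hB0 : 0 ≤ B := by
    have : 0 < 1 - v := by linarith
    positivity
  refine (intervalIntegral.norm_integral_le_of_norm_le_const
    (C := 7 * 2 ^ M / b * B) fun x hx => ?_).trans ?_
  · rw [Set.uIoc_of_le hab] at hx
    simp only [hG]
    rw [intervalIntegral.integral_const_mul, ← mul_sub, norm_mul]
    exact mul_le_mul (abs_bumpDeriv_le hb hM x) (hinner x ⟨hx.1.le, hx.2⟩) (norm_nonneg _)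
      (by positivity)
  · rw [abs_of_nonneg (by linarith)]
    calc 7 * 2 ^ M / b * B * (b - b / 2 ^ M) ≤ 7 * 2 ^ M / b * B * b := by
          apply mul_le_mul_of_nonneg_left _ (by positivity)
          have : 0 < b / 2 ^ M := by positivity
          linarith
      _ = _ := by field_simp

end bump

/-! ### The function on the circle and its modulus of continuity -/

/-- The right end of the support of the `k`th bump. -/
noncomputable def scale (k : ℕ) : ℝ := (1 / 2) ^ ((k + 1) ^ 4)

/-- The number of octaves in the support of the `k`th bump, of size `log log k`. The factor `16`
leaves room for the probabilities of the favourable events, which are at least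
`2 ^ (-2 ^ (12 * octaves k + 2))`, to have a divergent sum. -/
def octaves (k : ℕ) : ℕ := Nat.log 2 (Nat.log 2 k) / 16 + 1

lemma scale_pos (k : ℕ) : 0 < scale k := by unfold scale; positivity

lemma scale_zero : scale 0 = 1 / 2 := by norm_num [scale]

lemma scale_anti : Antitone scale := by
  intro j k h
  exact pow_le_pow_of_le_one (by norm_num) (by norm_num) (by gcongr)

lemma tendsto_scale : Tendsto scale atTop (𝓝 0) := by
  refine (tendsto_pow_atTop_nhds_zero_of_lt_one (r := (1 / 2 : ℝ)) (by norm_num)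
    (by norm_num)).comp ?_
  refine tendsto_atTop_mono (f := fun k => k) (fun k => ?_) tendsto_id
  exact (Nat.le_succ k).trans (Nat.le_self_pow (by norm_num) _)

lemma one_le_octaves (k : ℕ) : 1 ≤ octaves k := Nat.le_add_left _ _

lemma octaves_pos (k : ℕ) : (0 : ℝ) < octaves k := by exact_mod_cast one_le_octaves k

lemma octaves_mono : Monotone octaves := by
  intro j k h
  unfold octaves
  gcongr

lemma two_pow_octaves_le {k : ℕ} (hk : k ≠ 0) : 2 ^ octaves k ≤ 2 * k := by
  have h : octaves k ≤ Nat.log 2 k + 1 := by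
    unfold octaves
    have h1 := Nat.div_le_self (Nat.log 2 (Nat.log 2 k)) 16
    have h2 := Nat.log_le_self 2 (Nat.log 2 k)
    omega
  calc 2 ^ octaves k ≤ 2 ^ (Nat.log 2 k + 1) := Nat.pow_le_pow_right (by norm_num) h
    _ = 2 * 2 ^ Nat.log 2 k := by ring
    _ ≤ 2 * k := by have := Nat.pow_log_le_self 2 hk; omega

lemma octaves_le (k : ℕ) : octaves k ≤ k + 1 := by
  unfold octaves
  have h1 := Nat.div_le_self (Nat.log 2 (Nat.log 2 k)) 16
  have h2 := Nat.log_le_self 2 (Nat.log 2 k)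
  have h3 := Nat.log_le_self 2 k
  omega

lemma tendsto_octaves : Tendsto octaves atTop atTop := by
  refine tendsto_atTop_atTop.2 fun m => ⟨2 ^ 2 ^ (16 * m), fun k hk => ?_⟩
  have h1 : 2 ^ (16 * m) ≤ Nat.log 2 k := Nat.le_log_of_pow_le (by norm_num) hk
  have h2 : 16 * m ≤ Nat.log 2 (Nat.log 2 k) := Nat.le_log_of_pow_le (by norm_num) h1
  unfold octaves
  omega

lemma lt_two_pow_two_pow_octaves (k : ℕ) : k < 2 ^ 2 ^ (16 * octaves k) := by
  apply Nat.lt_pow_of_log_lt (by norm_num)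
  apply Nat.lt_pow_of_log_lt (by norm_num)
  unfold octaves
  omega

lemma scale_gap {j k : ℕ} (h : j < k) :
    2 ^ k ^ 3 * scale k ≤ scale j / 2 ^ octaves j := by
  have hM : octaves j ≤ k := (octaves_le j).trans h
  have hj : (j + 1) ^ 4 ≤ k ^ 4 := by gcongr; omega
  have he : k ^ 3 + ((j + 1) ^ 4 + octaves j) ≤ (k + 1) ^ 4 := by
    have : (k + 1) ^ 4 = k ^ 4 + 4 * k ^ 3 + 6 * k ^ 2 + 4 * k + 1 := by ring
    nlinarith [sq_nonneg k, pow_nonneg (Nat.zero_le k) 3]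
  unfold scale
  rw [le_div_iff₀ (by positivity)]
  obtain ⟨d, hd⟩ := Nat.exists_eq_add_of_le he
  rw [hd]
  have e : (2 : ℝ) ^ k ^ 3 * (1 / 2) ^ (k ^ 3 + ((j + 1) ^ 4 + octaves j) + d) * 2 ^ octaves j =
      (1 / 2) ^ ((j + 1) ^ 4) * (1 / 2) ^ d := by
    rw [pow_add, pow_add, pow_add, one_div, inv_pow, inv_pow, inv_pow]
    field_simp
  rw [e]
  exact mul_le_of_le_one_right (by positivity) (pow_le_one₀ (by norm_num) (by norm_num))

lemma scale_le_of_lt {j k : ℕ} (h : j < k) : scale k ≤ scale j / 2 ^ octaves j :=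
  (le_mul_of_one_le_left (scale_pos k).le (one_le_pow₀ (by norm_num))).trans (scale_gap h)

/-- The `k`th bump, of height `1 / log log k`. -/
noncomputable def bumpAt (k : ℕ) : ℝ → ℝ := bump (scale k) (octaves k)

/-- The sum of all bumps; their supports are disjoint and accumulate only at `0`. -/
noncomputable def bumpSum (x : ℝ) : ℝ := ∑' k, bumpAt k x

/-- The sum of the bumps of index at least `k`. -/
noncomputable def bumpTail (k : ℕ) (x : ℝ) : ℝ := bumpSum x - ∑ j ∈ Finset.range k, bumpAt j x

@[fun_prop]
lemma continuous_bumpAt (k : ℕ) : Continuous (bumpAt k) := continuous_bump _ _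

lemma bumpAt_of_le {k : ℕ} {x : ℝ} (h : x ≤ scale k / 2 ^ octaves k) : bumpAt k x = 0 :=
  bump_of_le (scale_pos k) h

lemma bumpAt_of_ge {k : ℕ} {x : ℝ} (h : scale k ≤ x) : bumpAt k x = 0 :=
  bump_of_ge (scale_pos k) h

lemma exists_forall_bumpAt_eq_zero (x : ℝ) : ∃ i, ∀ j ≠ i, bumpAt j x = 0 := by
  by_cases h : ∃ i, bumpAt i x ≠ 0
  · obtain ⟨i, hi⟩ := h
    have h1 : scale i / 2 ^ octaves i < x := by
      by_contra hx
      exact hi (bumpAt_of_le (not_lt.1 hx))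
    have h2 : x < scale i := by
      by_contra hx
      exact hi (bumpAt_of_ge (not_lt.1 hx))
    refine ⟨i, fun j hj => ?_⟩
    rcases lt_or_gt_of_ne hj with h | h
    · exact bumpAt_of_le (h2.le.trans (scale_le_of_lt h))
    · exact bumpAt_of_ge ((scale_le_of_lt h).trans h1.le)
  · push Not at h
    exact ⟨0, fun j _ => h j⟩

lemma bumpTail_eq (k : ℕ) (x : ℝ) : bumpTail k x = 0 ∨ ∃ i ≥ k, bumpTail k x = bumpAt i x := by
  obtain ⟨i, hi⟩ := exists_forall_bumpAt_eq_zero x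
  have hs : bumpSum x = bumpAt i x := tsum_eq_single i hi
  rcases lt_or_ge i k with h | h
  · left
    rw [bumpTail, hs, Finset.sum_eq_single i (fun j _ hj => hi j hj)
      (fun h' => absurd (Finset.mem_range.2 h) h'), sub_self]
  · refine Or.inr ⟨i, h, ?_⟩
    rw [bumpTail, hs, Finset.sum_eq_zero, sub_zero]
    intro j hj
    have := Finset.mem_range.1 hj
    exact hi j (by omega)

lemma abs_bumpTail_le (k : ℕ) (x : ℝ) : |bumpTail k x| ≤ 1 / octaves k := by
  rcases bumpTail_eq k x with h | ⟨i, hi, h⟩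
  · rw [h, abs_zero]; positivity
  · rw [h]
    refine (abs_bump_le _ _ _).trans ?_
    apply one_div_le_one_div_of_le (octaves_pos k)
    exact_mod_cast octaves_mono hi

lemma bumpTail_of_ge {k : ℕ} {x : ℝ} (h : scale k ≤ x) : bumpTail k x = 0 := by
  rcases bumpTail_eq k x with h' | ⟨i, hi, h'⟩
  · exact h'
  · rw [h', bumpAt_of_ge ((scale_anti hi).trans h)]

lemma bumpTail_zero (x : ℝ) : bumpTail 0 x = bumpSum x := by simp [bumpTail]

lemma bumpTail_succ (k : ℕ) (x : ℝ) : bumpTail k x = bumpAt k x + bumpTail (k + 1) x := by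
  rw [bumpTail, bumpTail, Finset.sum_range_succ]
  ring

lemma bumpSum_of_nonpos {x : ℝ} (h : x ≤ 0) : bumpSum x = 0 := by
  have : ∀ k, bumpAt k x = 0 := fun k => bumpAt_of_le (h.trans (by
    have := scale_pos k; positivity))
  simp [bumpSum, this]

lemma bumpSum_of_ge {x : ℝ} (h : 1 / 2 ≤ x) : bumpSum x = 0 := by
  rw [← bumpTail_zero]
  exact bumpTail_of_ge (scale_zero.trans_le h)

lemma abs_bumpSum_sub_le (k : ℕ) (x y : ℝ) :
    |bumpSum x - bumpSum y| ≤ 7 * k * (2 ^ k ^ 3 * scale k)⁻¹ * |x - y| + 2 / octaves k := by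
  have h1 : ∀ j ∈ Finset.range k, |bumpAt j x - bumpAt j y| ≤
      7 * (2 ^ k ^ 3 * scale k)⁻¹ * |x - y| := by
    intro j hj
    refine (abs_bump_sub_le (scale_pos j) (one_le_octaves j) x y).trans ?_
    have := inv_anti₀ (by have := scale_pos k; positivity) (scale_gap (Finset.mem_range.1 hj))
    gcongr
  have h2 : bumpSum x - bumpSum y = ∑ j ∈ Finset.range k, (bumpAt j x - bumpAt j y) +
      (bumpTail k x - bumpTail k y) := by
    rw [Finset.sum_sub_distrib, bumpTail, bumpTail]
    ring
  rw [h2]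
  refine (abs_add_le _ _).trans (add_le_add ?_ ?_)
  · refine (Finset.abs_sum_le_sum_abs _ _).trans ((Finset.sum_le_sum h1).trans ?_)
    rw [Finset.sum_const, Finset.card_range, nsmul_eq_mul]
    apply le_of_eq
    ring
  · refine (abs_sub _ _).trans ?_
    have := abs_bumpTail_le k x
    have := abs_bumpTail_le k y
    have e : (2 : ℝ) / octaves k = 1 / octaves k + 1 / octaves k := by ring
    linarith

/-- At distances at most `scale k` the oscillation of `bumpSum` is governed by the height of the
`k`th bump. -/
lemma abs_bumpSum_sub_le_of_le_scale {k : ℕ} {x y : ℝ} (h : |x - y| ≤ scale k) :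
    |bumpSum x - bumpSum y| ≤ 16 / octaves k := by
  refine (abs_bumpSum_sub_le k x y).trans ?_
  have hs := scale_pos k
  have hM := octaves_pos k
  have h1 : 7 * k * (2 ^ k ^ 3 * scale k)⁻¹ * |x - y| ≤ 14 / octaves k := by
    calc 7 * k * (2 ^ k ^ 3 * scale k)⁻¹ * |x - y|
        ≤ 7 * k * (2 ^ k ^ 3 * scale k)⁻¹ * scale k := by gcongr
      _ = 7 * k / 2 ^ k ^ 3 := by field_simp
      _ ≤ 14 / octaves k := by
        rw [div_le_div_iff₀ (by positivity) hM]
        have a1 : octaves k ≤ 2 ^ k := (octaves_le k).trans Nat.lt_two_pow_self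
        have a2 : k ≤ 2 ^ k := Nat.lt_two_pow_self.le
        have a3 : k * octaves k ≤ 2 * 2 ^ k ^ 3 := by
          calc k * octaves k ≤ 2 ^ k * 2 ^ k := Nat.mul_le_mul a2 a1
            _ = 2 ^ (2 * k) := by ring
            _ ≤ 2 ^ (k ^ 3 + 1) := by
              apply Nat.pow_le_pow_right (by norm_num)
              rcases k with _ | _ | k
              · norm_num
              · norm_num
              · nlinarith [sq_nonneg k]
            _ = _ := by ring
        have a4 : (k : ℝ) * octaves k ≤ 2 * 2 ^ k ^ 3 := by exact_mod_cast a3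
        nlinarith
  have e : (16 : ℝ) / octaves k = 14 / octaves k + 2 / octaves k := by ring
  linarith

@[fun_prop]
lemma continuous_bumpSum : Continuous bumpSum := by
  rw [Metric.continuous_iff]
  intro x ε hε
  obtain ⟨k, hk⟩ := ((tendsto_natCast_atTop_atTop (R := ℝ)).comp
    tendsto_octaves).eventually_gt_atTop (16 / ε) |>.exists
  refine ⟨scale k, scale_pos k, fun y hy => ?_⟩
  rw [Real.dist_eq] at hy ⊢
  refine (abs_bumpSum_sub_le_of_le_scale hy.le).trans_lt ?_
  rw [Function.comp_apply, div_lt_iff₀ hε] at hk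
  rw [div_lt_iff₀ (octaves_pos k)]
  linarith

@[fun_prop]
lemma continuous_bumpTail (k : ℕ) : Continuous (bumpTail k) := by
  unfold bumpTail
  fun_prop

/-- The function `bumpSum` on the circle. -/
noncomputable def circleBump : C(UnitAddCircle, ℝ) where
  toFun := AddCircle.liftIco 1 0 bumpSum
  continuous_toFun := AddCircle.liftIco_continuous
    (by rw [bumpSum_of_nonpos le_rfl, bumpSum_of_ge (by norm_num)]) continuous_bumpSum.continuousOn

lemma circleBump_coe {x : ℝ} (h : x ∈ Set.Icc (-1 / 2 : ℝ) 1) :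
    circleBump (x : UnitAddCircle) = bumpSum x := by
  have key : ∀ y ∈ Set.Ico (0 : ℝ) 1, circleBump (y : UnitAddCircle) = bumpSum y := fun y hy =>
    AddCircle.liftIco_coe_apply (p := 1) (a := 0) (f := bumpSum) (by rwa [zero_add])
  rcases lt_or_ge x 0 with h0 | h0
  · rw [← AddCircle.coe_add_period, key (x + 1) ⟨by linarith [h.1], by linarith⟩,
      bumpSum_of_nonpos h0.le, bumpSum_of_ge (by linarith [h.1])]
  · rcases h.2.lt_or_eq with h1 | h1
    · exact key x ⟨h0, h1⟩
    · have : ((x : ℝ) : UnitAddCircle) = ((0 : ℝ) : UnitAddCircle) := by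
        rw [h1]
        simp
      rw [this, key 0 (by simp), h1, bumpSum_of_nonpos le_rfl, bumpSum_of_ge (by norm_num)]

lemma abs_circleBump_sub_le {k : ℕ} {δ : ℝ} (hδ : δ ≤ scale k) (hδ' : δ ≤ 1 / 4)
    {x y : UnitAddCircle} (h : dist x y ≤ δ) :
    |circleBump x - circleBump y| ≤ 16 / octaves k := by
  have lift : ∀ z : UnitAddCircle, ∃ a ∈ Set.Ico (-1 / 4 : ℝ) (-1 / 4 + 1), (a : UnitAddCircle) = z :=
    fun z => ⟨AddCircle.equivIco 1 (-1 / 4) z, Subtype.coe_prop _, AddCircle.coe_equivIco⟩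
  obtain ⟨a, ha, rfl⟩ := lift x
  obtain ⟨b, hb, rfl⟩ := lift y
  rw [dist_eq_norm, ← AddCircle.coe_sub, UnitAddCircle.norm_eq] at h
  -- the representative of `y` that is nearest to `a`
  set b' : ℝ := b + round (a - b) with hb'
  have hbb : (b : UnitAddCircle) = (b' : UnitAddCircle) := by
    rw [hb', AddCircle.coe_add]
    have : (((round (a - b) : ℤ) : ℝ) : UnitAddCircle) = 0 := by
      rw [AddCircle.coe_eq_zero_iff]
      exact ⟨round (a - b), by simp⟩
    rw [this, add_zero]
  have hab : |a - b'| ≤ δ := by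
    rw [hb', ← sub_sub]
    exact h
  have hab' := abs_le.1 (hab.trans hδ')
  rw [hbb, circleBump_coe ⟨by linarith [ha.1], by linarith [ha.2]⟩,
    circleBump_coe ⟨by linarith [ha.1, hab'.2], by linarith [ha.2, hab'.1]⟩]
  exact abs_bumpSum_sub_le_of_le_scale (hab.trans hδ)

lemma modulusOfContinuity_circleBump_le {k : ℕ} {δ : ℝ} (hδ : δ ≤ scale k) (hδ' : δ ≤ 1 / 4) :
    modulusOfContinuity circleBump δ ≤ 16 / octaves k := by
  refine Real.sSup_le ?_ (by positivity)
  rintro d ⟨x, y, hxy, rfl⟩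
  exact abs_circleBump_sub_le hδ hδ' hxy

lemma log_add_two_le (k : ℕ) : Real.log (k + 2) ≤ 2 ^ (16 * octaves k + 1) := by
  have h : ((k + 2 : ℕ) : ℝ) ≤ ((2 ^ (2 ^ (16 * octaves k) + 1) : ℕ) : ℝ) := by
    have h1 := lt_two_pow_two_pow_octaves k
    have h2 : 2 ≤ 2 ^ 2 ^ (16 * octaves k) := Nat.le_self_pow (by positivity) 2
    rw [pow_succ]
    exact_mod_cast (by omega : k + 2 ≤ 2 ^ 2 ^ (16 * octaves k) * 2)
  push_cast at h
  refine (Real.log_le_log (by positivity) h).trans ?_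
  rw [Real.log_pow]
  have h3 : Real.log 2 ≤ 1 := by linarith [Real.log_two_lt_d9]
  have h4 : (1 : ℝ) ≤ 2 ^ (16 * octaves k) := one_le_pow₀ (by norm_num)
  have h5 : (0 : ℝ) ≤ Real.log 2 := Real.log_nonneg (by norm_num)
  push_cast
  rw [pow_succ]
  nlinarith

lemma log_log_log_one_div_le {k : ℕ} {δ : ℝ} (hδ : scale (k + 1) ≤ δ)
    (h1 : 0 < Real.log (1 / δ)) (h2 : 0 < Real.log (Real.log (1 / δ))) :
    Real.log (Real.log (Real.log (1 / δ))) ≤ 19 * octaves k := by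
  have hδ0 : 0 < δ := (scale_pos _).trans_le hδ
  have a1 : Real.log (1 / δ) ≤ (k + 2) ^ 4 := by
    have : 1 / δ ≤ 2 ^ (k + 2) ^ 4 := by
      refine (one_div_le_one_div_of_le (scale_pos _) hδ).trans_eq ?_
      rw [scale, one_div_pow, one_div_one_div]
    refine (Real.log_le_log (by positivity) this).trans ?_
    rw [Real.log_pow]
    push_cast
    exact mul_le_of_le_one_right (by positivity) (by linarith [Real.log_two_lt_d9])
  have a2 : Real.log (Real.log (1 / δ)) ≤ 2 ^ (16 * octaves k + 3) := by
    refine (Real.log_le_log h1 a1).trans ?_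
    rw [Real.log_pow]
    have := log_add_two_le k
    rw [pow_succ] at this
    rw [pow_succ, pow_succ, pow_succ]
    push_cast
    linarith
  refine (Real.log_le_log h2 a2).trans ?_
  rw [Real.log_pow]
  have h3 : Real.log 2 ≤ 1 := by linarith [Real.log_two_lt_d9]
  have h4 : (1 : ℝ) ≤ octaves k := by exact_mod_cast one_le_octaves k
  have h5 : (0 : ℝ) ≤ Real.log 2 := Real.log_nonneg (by norm_num)
  push_cast
  nlinarith

lemma exists_scale_succ_le {δ : ℝ} (h0 : 0 < δ) (h : δ < scale 0) :
    ∃ k, scale (k + 1) ≤ δ ∧ δ < scale k := by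
  classical
  have hex : ∃ k, scale k ≤ δ := (tendsto_scale.eventually_le_const h0).exists
  obtain ⟨k, hk⟩ := Nat.exists_eq_succ_of_ne_zero (n := Nat.find hex) fun h' =>
    absurd (h' ▸ Nat.find_spec hex) (not_le.2 h)
  have hspec := Nat.find_spec hex
  rw [hk] at hspec
  exact ⟨k, hspec, not_le.1 (Nat.find_min hex (by omega))⟩

theorem modulusOfContinuity_circleBump_isBigO :
    (fun δ : ℝ => modulusOfContinuity circleBump δ) =O[𝓝[>] 0]
      fun δ : ℝ => (Real.log (Real.log (Real.log (1 / δ))))⁻¹ := by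
  have hinv : Tendsto (fun δ : ℝ => 1 / δ) (𝓝[>] 0) atTop := by
    simpa only [one_div] using tendsto_inv_nhdsGT_zero (𝕜 := ℝ)
  have hl1 := Real.tendsto_log_atTop.comp hinv
  have hl2 := Real.tendsto_log_atTop.comp hl1
  have hl3 := Real.tendsto_log_atTop.comp hl2
  refine Asymptotics.IsBigO.of_bound (16 * 19) ?_
  filter_upwards [hl1.eventually_gt_atTop 0, hl2.eventually_gt_atTop 0, hl3.eventually_gt_atTop 0,
    Ioo_mem_nhdsGT (by norm_num : (0 : ℝ) < 1 / 4)] with δ h1 h2 h3 h4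
  simp only [Function.comp_apply] at h1 h2 h3
  obtain ⟨k, hk, hk'⟩ := exists_scale_succ_le h4.1 (by rw [scale_zero]; linarith [h4.2])
  have hL := log_log_log_one_div_le hk h1 h2
  have hM := octaves_pos k
  have hω : 0 ≤ modulusOfContinuity circleBump δ := by
    refine Real.sSup_nonneg ?_
    rintro d ⟨x, y, _, rfl⟩
    exact abs_nonneg _
  rw [Real.norm_of_nonneg hω, Real.norm_of_nonneg (inv_nonneg.2 h3.le)]
  refine (modulusOfContinuity_circleBump_le hk'.le h4.2.le).trans ?_
  rw [← div_eq_mul_inv, div_le_div_iff₀ hM h3]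
  linarith

theorem abs_circleBump_sub_zero_isBigO :
    (fun δ : ℝ => |circleBump (δ : UnitAddCircle) - circleBump 0|) =O[𝓝[≠] 0]
      fun δ : ℝ => (Real.log (Real.log (Real.log (1 / |δ|))))⁻¹ := by
  have habs : Tendsto (fun δ : ℝ => |δ|) (𝓝[≠] 0) (𝓝[>] 0) := tendsto_abs_nhdsNE_zero
  refine Asymptotics.IsBigO.trans ?_ (modulusOfContinuity_circleBump_isBigO.comp_tendsto habs)
  refine Asymptotics.IsBigO.of_bound 1 (Filter.Eventually.of_forall fun δ => ?_)
  simp only [Function.comp_apply, one_mul, Real.norm_eq_abs, abs_abs]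
  refine le_trans ?_ (le_abs_self _)
  refine le_csSup ?_ ⟨(δ : UnitAddCircle), 0, ?_, rfl⟩
  · obtain ⟨C, hC⟩ := (isCompact_univ (X := UnitAddCircle)).exists_bound_of_continuousOn
      circleBump.continuous.continuousOn
    refine ⟨C + C, ?_⟩
    rintro d ⟨x, y, _, rfl⟩
    exact (abs_sub _ _).trans (add_le_add (hC x trivial) (hC y trivial))
  · rw [dist_zero_right, UnitAddCircle.norm_eq]
    simpa using round_le δ 0

/-! ### Dyadic values and the homeomorphism they define -/

section dyadic
variable {U : DyadicIndex → ℝ}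

lemma dyadicValue_two_mul (U : DyadicIndex → ℝ) (n k : ℕ) :
    dyadicValue U (n + 1) (2 * k) = dyadicValue U n k := by
  rw [dyadicValue, dif_neg (by simp), Nat.mul_div_cancel_left _ (by norm_num)]

lemma odd_lt_two_pow_succ {n k : ℕ} (hk : k < 2 ^ n) :
    Odd (2 * k + 1) ∧ 2 * k + 1 < 2 ^ (n + 1) :=
  ⟨odd_two_mul_add_one k, by rw [pow_succ]; omega⟩

/-- The index of the midpoint of the `k`th dyadic interval of level `n`. -/
def midIndex (n k : ℕ) (hk : k < 2 ^ n) : DyadicIndex :=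
  ⟨(n + 1, 2 * k + 1), odd_lt_two_pow_succ hk⟩

lemma dyadicValue_two_mul_add_one (U : DyadicIndex → ℝ) {n k : ℕ} (hk : k < 2 ^ n) :
    dyadicValue U (n + 1) (2 * k + 1) = dyadicValue U n k +
      U (midIndex n k hk) * (dyadicValue U n (k + 1) - dyadicValue U n k) := by
  rw [dyadicValue, dif_pos (odd_lt_two_pow_succ hk)]
  have h1 : (2 * k + 1 - 1) / 2 = k := by omega
  have h2 : (2 * k + 1 + 1) / 2 = k + 1 := by omega
  rw [h1, h2]
  rfl

@[simp]
lemma dyadicValue_zero_right (U : DyadicIndex → ℝ) (n : ℕ) : dyadicValue U n 0 = 0 := by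
  induction n with
  | zero => simp [dyadicValue]
  | succ n ih => rw [← mul_zero 2, dyadicValue_two_mul, ih]

lemma dyadicValue_two_pow_mul (U : DyadicIndex → ℝ) (n m k : ℕ) :
    dyadicValue U (n + m) (2 ^ m * k) = dyadicValue U n k := by
  induction m with
  | zero => simp
  | succ m ih => rw [← add_assoc, pow_succ', mul_assoc, dyadicValue_two_mul, ih]

@[simp]
lemma dyadicValue_two_pow (U : DyadicIndex → ℝ) (n : ℕ) : dyadicValue U n (2 ^ n) = 1 := by
  have := dyadicValue_two_pow_mul U 0 n 1
  rw [zero_add, mul_one] at this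
  rw [this]
  simp [dyadicValue]

lemma dyadicValue_lt_succ (hU : ∀ i, U i ∈ Set.Ioo (0 : ℝ) 1) {n k : ℕ} (hk : k < 2 ^ n) :
    dyadicValue U n k < dyadicValue U n (k + 1) := by
  induction n generalizing k with
  | zero => simp [dyadicValue]
  | succ n ih =>
    rcases Nat.even_or_odd' k with ⟨j, rfl | rfl⟩
    · have hj : j < 2 ^ n := by rw [pow_succ] at hk; omega
      rw [dyadicValue_two_mul, dyadicValue_two_mul_add_one U hj]
      nlinarith [ih hj, (hU (midIndex n j hj)).1]
    · have hj : j < 2 ^ n := by rw [pow_succ] at hk; omega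
      rw [show 2 * j + 1 + 1 = 2 * (j + 1) by ring, dyadicValue_two_mul,
        dyadicValue_two_mul_add_one U hj]
      nlinarith [ih hj, (hU (midIndex n j hj)).2]

lemma dyadicValue_strictMonoOn (hU : ∀ i, U i ∈ Set.Ioo (0 : ℝ) 1) (n : ℕ) :
    StrictMonoOn (dyadicValue U n) (Set.Iic (2 ^ n)) := by
  intro j hj k hk hjk
  induction k with
  | zero => omega
  | succ k ih =>
    simp only [Set.mem_Iic] at hj hk ih
    have hlt := dyadicValue_lt_succ hU (n := n) (k := k) (by omega)
    rcases Nat.lt_succ_iff_lt_or_eq.1 hjk with h | h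
    · exact (ih (by omega) h).trans hlt
    · rw [h]; exact hlt

/-- The dyadic values are monotone in the dyadic point, across levels. -/
lemma dyadicValue_le_of_div_le (hU : ∀ i, U i ∈ Set.Ioo (0 : ℝ) 1) {n m j k : ℕ}
    (hk : k ≤ 2 ^ m) (h : (j : ℝ) / 2 ^ n ≤ (k : ℝ) / 2 ^ m) :
    dyadicValue U n j ≤ dyadicValue U m k := by
  rw [← dyadicValue_two_pow_mul U n m j, ← dyadicValue_two_pow_mul U m n k, add_comm m n]
  rw [div_le_div_iff₀ (by positivity) (by positivity)] at h
  have h' : j * 2 ^ m ≤ k * 2 ^ n := by exact_mod_cast h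
  have h2 : 2 ^ n * k ≤ 2 ^ (n + m) := by rw [pow_add]; exact Nat.mul_le_mul_left _ hk
  apply (dyadicValue_strictMonoOn hU (n + m)).monotoneOn
  · simp only [Set.mem_Iic]; nlinarith
  · exact h2
  · nlinarith

lemma dyadicValue_mem_Icc (hU : ∀ i, U i ∈ Set.Ioo (0 : ℝ) 1) {n k : ℕ} (hk : k ≤ 2 ^ n) :
    dyadicValue U n k ∈ Set.Icc (0 : ℝ) 1 := by
  have h := (dyadicValue_strictMonoOn hU n).monotoneOn
  constructor
  · rw [← dyadicValue_zero_right U n]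
    exact h (by simp) hk (by simp)
  · rw [← dyadicValue_two_pow U n]
    exact h hk (by simp) hk

/-- The set of dyadic values at the dyadic points up to `t`. -/
def dyadicLower (U : DyadicIndex → ℝ) (t : ℝ) : Set ℝ :=
  {y | ∃ n k : ℕ, k ≤ 2 ^ n ∧ (k : ℝ) / 2 ^ n ≤ t ∧ y = dyadicValue U n k}

lemma bddAbove_dyadicLower (hU : ∀ i, U i ∈ Set.Ioo (0 : ℝ) 1) (t : ℝ) :
    BddAbove (dyadicLower U t) := by
  refine ⟨1, ?_⟩
  rintro y ⟨n, k, hk, _, rfl⟩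
  exact (dyadicValue_mem_Icc hU hk).2

lemma zero_mem_dyadicLower (U : DyadicIndex → ℝ) {t : ℝ} (ht : 0 ≤ t) : 0 ∈ dyadicLower U t :=
  ⟨0, 0, by simp, by simpa using ht, by simp⟩

lemma sSup_dyadicLower_mem_Icc (hU : ∀ i, U i ∈ Set.Ioo (0 : ℝ) 1) {t : ℝ} (ht : 0 ≤ t) :
    sSup (dyadicLower U t) ∈ Set.Icc (0 : ℝ) 1 := by
  refine ⟨le_csSup (bddAbove_dyadicLower hU t) (zero_mem_dyadicLower U ht), ?_⟩
  refine csSup_le ⟨0, zero_mem_dyadicLower U ht⟩ ?_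
  rintro y ⟨n, k, hk, _, rfl⟩
  exact (dyadicValue_mem_Icc hU hk).2

lemma sSup_dyadicLower_dyadic (hU : ∀ i, U i ∈ Set.Ioo (0 : ℝ) 1) {n k : ℕ} (hk : k ≤ 2 ^ n) :
    sSup (dyadicLower U ((k : ℝ) / 2 ^ n)) = dyadicValue U n k := by
  have h0 : (0 : ℝ) ≤ (k : ℝ) / 2 ^ n := by positivity
  apply le_antisymm
  · refine csSup_le ⟨0, zero_mem_dyadicLower U h0⟩ ?_
    rintro y ⟨m, j, hj, hjk, rfl⟩
    exact dyadicValue_le_of_div_le hU hk hjk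
  · exact le_csSup (bddAbove_dyadicLower hU _) ⟨n, k, hk, le_rfl, rfl⟩

lemma exists_dyadic_between {s t : ℝ} (h0 : 0 ≤ s) (h1 : t ≤ 1) (h : s < t) :
    ∃ n j k : ℕ, k ≤ 2 ^ n ∧ j < k ∧ s ≤ (j : ℝ) / 2 ^ n ∧ (k : ℝ) / 2 ^ n ≤ t := by
  obtain ⟨n, hn⟩ := exists_pow_lt_of_lt_one (show 0 < (t - s) / 2 by linarith)
    (by norm_num : (1 / 2 : ℝ) < 1)
  have hp : (0 : ℝ) < 2 ^ n := by positivity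
  rw [one_div, inv_pow, inv_lt_iff_one_lt_mul₀ hp] at hn
  set j := ⌈s * 2 ^ n⌉₊ with hj
  have hj1 : s * 2 ^ n ≤ j := Nat.le_ceil _
  have hj2 : (j : ℝ) < s * 2 ^ n + 1 := Nat.ceil_lt_add_one (by positivity)
  have hk : ((j + 1 : ℕ) : ℝ) / 2 ^ n ≤ t := by
    rw [div_le_iff₀ hp]
    push_cast
    nlinarith
  refine ⟨n, j, j + 1, ?_, Nat.lt_succ_self j, by rwa [le_div_iff₀ hp], hk⟩
  have := hk.trans h1
  rw [div_le_one hp] at this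
  exact_mod_cast this

/-- Parameters in `(0, 1)` for which the gaps between dyadic values shrink to `0` define a
homeomorphism of `[0, 1]`. -/
theorem exists_extendsDyadic (hU : ∀ i, U i ∈ Set.Ioo (0 : ℝ) 1)
    (hmesh : ∀ ε > 0, ∃ n : ℕ, ∀ k < 2 ^ n, dyadicValue U n (k + 1) - dyadicValue U n k < ε) :
    ∃ φ : unitInterval ≃ₜ unitInterval, ExtendsDyadic U φ ∧ StrictMono φ := by
  set F : unitInterval → unitInterval := fun t =>
    ⟨sSup (dyadicLower U t), sSup_dyadicLower_mem_Icc hU t.2.1⟩ with hF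
  have hdy : ∀ (n k : ℕ) (t : unitInterval), (t : ℝ) = (k : ℝ) / 2 ^ n →
      (F t : ℝ) = dyadicValue U n k := by
    intro n k t ht
    have hk : k ≤ 2 ^ n := by
      have := t.2.2
      rw [ht, div_le_one (by positivity)] at this
      exact_mod_cast this
    simp only [hF, ht]
    exact sSup_dyadicLower_dyadic hU hk
  have hmono : StrictMono F := by
    intro s t hst
    obtain ⟨n, j, k, hk, hjk, hsj, hkt⟩ := exists_dyadic_between s.2.1 t.2.2 hst
    rw [← Subtype.coe_lt_coe]
    calc sSup (dyadicLower U s) ≤ dyadicValue U n j := by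
          refine csSup_le ⟨0, zero_mem_dyadicLower U s.2.1⟩ ?_
          rintro y ⟨m, i, hi, hi', rfl⟩
          exact dyadicValue_le_of_div_le hU (hjk.le.trans hk) (hi'.trans hsj)
      _ < dyadicValue U n k := dyadicValue_strictMonoOn hU n (hjk.le.trans hk) hk hjk
      _ ≤ sSup (dyadicLower U t) :=
          le_csSup (bddAbove_dyadicLower hU _) ⟨n, k, hk, hkt, rfl⟩
  have hdense : DenseRange F := by
    rw [Metric.denseRange_iff]
    intro y ε hε
    obtain ⟨n, hn⟩ := hmesh ε hε
    classical
    set k := Nat.findGreatest (fun k => dyadicValue U n k ≤ y) (2 ^ n) with hkdef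
    have hk : k ≤ 2 ^ n := Nat.findGreatest_le _
    have hky : dyadicValue U n k ≤ y :=
      Nat.findGreatest_spec (P := fun k => dyadicValue U n k ≤ y) (Nat.zero_le _)
        (by simpa using y.2.1)
    have hmem : (k : ℝ) / 2 ^ n ∈ Set.Icc (0 : ℝ) 1 := by
      refine ⟨by positivity, (div_le_one (by positivity)).2 (by exact_mod_cast hk)⟩
    refine ⟨⟨(k : ℝ) / 2 ^ n, hmem⟩, ?_⟩
    rw [Subtype.dist_eq, hdy n k _ rfl, Real.dist_eq, abs_of_nonneg (by linarith)]
    rcases hk.lt_or_eq with hlt | heq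
    · have : (y : ℝ) < dyadicValue U n (k + 1) := by
        by_contra h
        exact Nat.findGreatest_is_greatest (Nat.lt_succ_self k) hlt (not_lt.1 h)
      linarith [hn k hlt]
    · rw [heq, dyadicValue_two_pow]
      linarith [y.2.2]
  have hcont : Continuous F := hmono.monotone.continuous_of_denseRange hdense
  have hsurj : Function.Surjective F := by
    intro y
    have h0 : F 0 ≤ y := by
      rw [← Subtype.coe_le_coe, hdy 0 0 0 (by simp)]
      simpa using y.2.1
    have h1 : y ≤ F 1 := by
      rw [← Subtype.coe_le_coe, hdy 0 1 1 (by simp)]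
      simpa [dyadicValue] using y.2.2
    exact mem_range_of_exists_le_of_exists_ge hcont ⟨0, h0⟩ ⟨1, h1⟩
  exact ⟨(StrictMono.orderIsoOfSurjective F hmono hsurj).toHomeomorph, hdy, hmono⟩

/-! ### The values at `2 ^ (-m)` and almost linear behaviour below them -/

/-- The index of the dyadic point `2 ^ (-(m + 1))`. -/
def spineIndex (m : ℕ) : DyadicIndex := ⟨(m + 1, 1), by simp⟩

lemma spine_zero (U : DyadicIndex → ℝ) : dyadicValue U 0 1 = 1 := by simp [dyadicValue]

lemma spine_succ (U : DyadicIndex → ℝ) (m : ℕ) :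
    dyadicValue U (m + 1) 1 = U (spineIndex m) * dyadicValue U m 1 := by
  have := dyadicValue_two_mul_add_one U (n := m) (k := 0) (by positivity)
  rw [show midIndex m 0 (by positivity) = spineIndex m from rfl] at this
  simpa using this

lemma spine_pos (hU : ∀ i, U i ∈ Set.Ioo (0 : ℝ) 1) (m : ℕ) : 0 < dyadicValue U m 1 := by
  have := dyadicValue_lt_succ hU (n := m) (k := 0) (by positivity)
  simpa using this

lemma spine_anti (hU : ∀ i, U i ∈ Set.Ioo (0 : ℝ) 1) : Antitone fun m => dyadicValue U m 1 := by
  refine antitone_nat_of_succ_le fun m => ?_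
  rw [spine_succ]
  exact mul_le_of_le_one_left (spine_pos hU m).le (hU _).2.le

/-- The parameters at the dyadic points of `(0, 2 ^ (-m))` of the next `H` levels are within `δ` of
`1 / 2`. -/
def NearlyLinear (U : DyadicIndex → ℝ) (m H : ℕ) (δ : ℝ) : Prop :=
  ∀ i : DyadicIndex, m < i.1.1 → i.1.1 ≤ m + H → i.1.2 < 2 ^ (i.1.1 - m) → |U i - 1 / 2| ≤ δ

lemma abs_dyadicValue_sub_le (hU : ∀ i, U i ∈ Set.Ioo (0 : ℝ) 1) {m H : ℕ} {δ : ℝ}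
    (h : NearlyLinear U m H δ) {l : ℕ} (hl : l ≤ H) {j : ℕ} (hj : j ≤ 2 ^ l) :
    |dyadicValue U (m + l) j - dyadicValue U m 1 * (j / 2 ^ l)| ≤ l * δ * dyadicValue U m 1 := by
  have hR := spine_pos hU m
  induction l generalizing j with
  | zero =>
    rw [pow_zero] at hj
    interval_cases j <;> simp
  | succ l ih =>
    have hδ : 0 ≤ δ := (abs_nonneg _).trans
      (h (spineIndex m) (by simp [spineIndex]) (by simp [spineIndex]; omega) (by simp [spineIndex]))
    rw [← add_assoc]
    rcases Nat.even_or_odd' j with ⟨i, rfl | rfl⟩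
    · have hi : i ≤ 2 ^ l := by rw [pow_succ] at hj; omega
      rw [dyadicValue_two_mul]
      have e : (((2 * i : ℕ) : ℝ) / 2 ^ (l + 1)) = i / 2 ^ l := by
        push_cast
        rw [pow_succ]
        field_simp
      rw [e]
      refine (ih (by omega) hi).trans ?_
      push_cast
      nlinarith [mul_nonneg hδ hR.le]
    · have hi : i < 2 ^ l := by rw [pow_succ] at hj; omega
      have hi' : i < 2 ^ (m + l) := hi.trans_le (Nat.pow_le_pow_right (by norm_num) (by omega))
      rw [dyadicValue_two_mul_add_one U hi']
      have h1 := ih (by omega) hi.le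
      have h2 := ih (by omega) (Nat.succ_le_of_lt hi)
      have h3 : |U (midIndex (m + l) i hi') - 1 / 2| ≤ δ := by
        apply h
        · simp only [midIndex]; omega
        · simp only [midIndex]; omega
        · simp only [midIndex]
          rw [show m + l + 1 - m = l + 1 by omega, pow_succ]
          omega
      have h4 : 0 < dyadicValue U (m + l) (i + 1) - dyadicValue U (m + l) i :=
        sub_pos.2 (dyadicValue_lt_succ hU hi')
      have h5 : dyadicValue U (m + l) (i + 1) ≤ dyadicValue U m 1 := by
        apply dyadicValue_le_of_div_le hU (Nat.one_le_two_pow)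
        rw [div_le_div_iff₀ (by positivity) (by positivity), pow_add]
        have : ((i + 1 : ℕ) : ℝ) ≤ 2 ^ l := by exact_mod_cast hi
        have : (0 : ℝ) < 2 ^ m := by positivity
        push_cast at *
        nlinarith
      have h6 : 0 ≤ dyadicValue U (m + l) i := (dyadicValue_mem_Icc hU hi'.le).1
      set R := dyadicValue U m 1
      set a := dyadicValue U (m + l) i
      set b := dyadicValue U (m + l) (i + 1)
      set u := U (midIndex (m + l) i hi')
      have e : R * (((2 * i + 1 : ℕ) : ℝ) / 2 ^ (l + 1)) =
          (R * (i / 2 ^ l) + R * (((i + 1 : ℕ) : ℝ) / 2 ^ l)) / 2 := by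
        push_cast
        rw [pow_succ]
        field_simp
        ring
      rw [e]
      have h7 : |(u - 1 / 2) * (b - a)| ≤ δ * R := by
        rw [abs_mul, abs_of_pos h4]
        exact mul_le_mul h3 (by linarith) h4.le hδ
      rw [abs_le] at h1 h2 h7 ⊢
      push_cast at *
      constructor <;> nlinarith [h1.1, h1.2, h2.1, h2.2, h7.1, h7.2]

end dyadic

/-! ### Partial sums of a function composed with a favourable homeomorphism -/

/-- The number of levels below a crossing on which the parameters are controlled. -/
def depth (k : ℕ) : ℕ := 4 * octaves k

/-- `2 ^ (-m)` is the first of the points `2 ^ (-i)` whose value is at most `2 * scale k`. -/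
def IsCrossing (U : DyadicIndex → ℝ) (k m : ℕ) : Prop :=
  (∀ i < m, 2 * scale k < dyadicValue U i 1) ∧ dyadicValue U m 1 ≤ 2 * scale k

/-- At the crossing `2 ^ (-m)` the value nearly equals `2 * scale k`, and the homeomorphism is nearly
linear on `[0, 2 ^ (-m)]`. -/
def IsFavourable (U : DyadicIndex → ℝ) (k m : ℕ) : Prop :=
  IsCrossing U k m ∧ (1 - (1 / 2) ^ depth k) * (2 * scale k) ≤ dyadicValue U m 1 ∧
    NearlyLinear U m (depth k) ((1 / 4) ^ depth k)

/-- `g` is the extension of an increasing homeomorphism of `[0, 1]` with the dyadic values given by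
`U`. -/
structure IsHomeoOf (U : DyadicIndex → ℝ) (g : ℝ → ℝ) : Prop where
  mem : ∀ i, U i ∈ Set.Ioo (0 : ℝ) 1
  cont : Continuous g
  mono : StrictMonoOn g (Set.Icc 0 1)
  val : ∀ n k : ℕ, k ≤ 2 ^ n → g ((k : ℝ) / 2 ^ n) = dyadicValue U n k

lemma exists_lt_mul_mem_Icc {N : ℕ} (hN : 0 < N) {s : ℝ} (h0 : 0 ≤ s) (h1 : s ≤ 1) :
    ∃ j < N, (j : ℝ) ≤ N * s ∧ N * s ≤ ((j + 1 : ℕ) : ℝ) := by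
  have hN' : (0 : ℝ) < N := by exact_mod_cast hN
  rcases h1.lt_or_eq with h | h
  · refine ⟨⌊N * s⌋₊, ?_, Nat.floor_le (by positivity), ?_⟩
    · rw [Nat.floor_lt (by positivity)]
      nlinarith
    · push_cast
      exact (Nat.lt_floor_add_one _).le
  · refine ⟨N - 1, by omega, ?_, ?_⟩
    · rw [h, mul_one]
      exact_mod_cast Nat.sub_le _ _
    · rw [h, mul_one, Nat.sub_add_cancel hN]

section composition
variable {U : DyadicIndex → ℝ} {g : ℝ → ℝ}

lemma IsHomeoOf.spine (hg : IsHomeoOf U g) (m : ℕ) : g ((1 / 2) ^ m) = dyadicValue U m 1 := by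
  have := hg.val m 1 Nat.one_le_two_pow
  rwa [Nat.cast_one, ← one_div_pow] at this

lemma half_pow_mem (m : ℕ) : ((1 / 2 : ℝ) ^ m) ∈ Set.Icc (0 : ℝ) 1 :=
  ⟨by positivity, pow_le_one₀ (by norm_num) (by norm_num)⟩

lemma mul_quarter_pow_le (H : ℕ) : (H : ℝ) * (1 / 4) ^ H ≤ (1 / 2) ^ H := by
  have h : (H : ℝ) ≤ 2 ^ H := by exact_mod_cast Nat.lt_two_pow_self.le
  have e : ((1 : ℝ) / 4) ^ H = (1 / 2) ^ H * (1 / 2) ^ H := by rw [← mul_pow]; norm_num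
  have e2 : (2 : ℝ) ^ H * (1 / 2) ^ H = 1 := by rw [← mul_pow]; norm_num
  have h3 : (0 : ℝ) < (1 / 2) ^ H := by positivity
  rw [e]
  nlinarith [mul_le_mul_of_nonneg_right h (mul_pos h3 h3).le]

/-- On `[0, 2 ^ (-m)]` a favourable homeomorphism is within `3 * 2 ^ (-depth k)` of linear, in
relative terms. -/
lemma abs_sub_linear_le (hg : IsHomeoOf U g) {k m : ℕ} (hf : IsFavourable U k m) {t : ℝ}
    (h0 : 0 ≤ t) (h1 : t ≤ (1 / 2) ^ m) :
    |g t - 2 * scale k * (2 ^ m * t)| ≤ 3 * (1 / 2) ^ depth k * (2 * scale k) := by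
  obtain ⟨⟨_, hR2⟩, hR1, hlin⟩ := hf
  set H := depth k
  set R := dyadicValue U m 1
  set β := 2 * scale k
  have hR : 0 < R := spine_pos hg.mem m
  set s := 2 ^ m * t with hs
  have hs0 : 0 ≤ s := by positivity
  have hpm : (2 : ℝ) ^ m * (1 / 2) ^ m = 1 := by rw [← mul_pow]; norm_num
  have hs1 : s ≤ 1 := by
    rw [← hpm]
    exact mul_le_mul_of_nonneg_left h1 (by positivity)
  obtain ⟨j, hj, hj1, hj2⟩ := exists_lt_mul_mem_Icc (N := 2 ^ H) (by positivity) hs0 hs1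
  push_cast at hj1
  have hpow : (2 : ℝ) ^ (m + H) = 2 ^ m * 2 ^ H := pow_add _ _ _
  have hjm : j + 1 ≤ 2 ^ (m + H) :=
    (Nat.succ_le_of_lt hj).trans (Nat.pow_le_pow_right (by norm_num) (by omega))
  have hmem : ∀ i : ℕ, i ≤ 2 ^ (m + H) → (i : ℝ) / 2 ^ (m + H) ∈ Set.Icc (0 : ℝ) 1 := fun i hi =>
    ⟨by positivity, (div_le_one (by positivity)).2 (by exact_mod_cast hi)⟩
  have ht : t ∈ Set.Icc (0 : ℝ) 1 := ⟨h0, h1.trans (half_pow_mem m).2⟩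
  have hl : dyadicValue U (m + H) j ≤ g t := by
    rw [← hg.val _ _ (by omega)]
    apply hg.mono.monotoneOn (hmem j (by omega)) ht
    rw [div_le_iff₀ (by positivity), hpow]
    nlinarith
  have hu : g t ≤ dyadicValue U (m + H) (j + 1) := by
    rw [← hg.val _ _ hjm]
    apply hg.mono.monotoneOn ht (hmem (j + 1) hjm)
    rw [le_div_iff₀ (by positivity), hpow]
    push_cast at hj2 ⊢
    nlinarith
  have e1 := abs_le.1 (abs_dyadicValue_sub_le hg.mem hlin le_rfl hj.le)
  have e2 := abs_le.1 (abs_dyadicValue_sub_le hg.mem hlin le_rfl (Nat.succ_le_of_lt hj))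
  have hq := mul_quarter_pow_le H
  have hpos : (0 : ℝ) < (1 / 2) ^ H := by positivity
  have hHH : (2 : ℝ) ^ H * (1 / 2) ^ H = 1 := by rw [← mul_pow]; norm_num
  have d : ∀ x : ℝ, x / 2 ^ H = x * (1 / 2) ^ H := by
    intro x
    rw [one_div, inv_pow, div_eq_mul_inv]
  rw [d] at e1 e2
  have b1 : (j : ℝ) * (1 / 2) ^ H ≤ s := by nlinarith
  have b2 : s ≤ (j : ℝ) * (1 / 2) ^ H + (1 / 2) ^ H := by
    push_cast at hj2
    nlinarith
  have hqR : (H : ℝ) * (1 / 4) ^ H * R ≤ (1 / 2) ^ H * R := mul_le_mul_of_nonneg_right hq hR.le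
  have hRβ : (1 / 2) ^ H * R ≤ (1 / 2) ^ H * β := mul_le_mul_of_nonneg_left hR2 hpos.le
  have hc1 : R * ((j : ℝ) * (1 / 2) ^ H) ≤ R * s := mul_le_mul_of_nonneg_left b1 hR.le
  have hc2 : R * s ≤ R * ((j : ℝ) * (1 / 2) ^ H + (1 / 2) ^ H) := mul_le_mul_of_nonneg_left b2 hR.le
  have hc3 : R * s ≤ β * s := mul_le_mul_of_nonneg_right hR2 hs0
  have hc4 : β * s - (1 / 2) ^ H * β ≤ R * s := by
    have : (β - R) * s ≤ (β - R) * 1 := mul_le_mul_of_nonneg_left hs1 (by linarith)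
    nlinarith
  rw [abs_le]
  push_cast at e2
  constructor <;> nlinarith [e1.1, e2.2]

/-- An integrand that is bounded and vanishes beyond `w` has a small integral against the Dirichlet
kernel. -/
lemma abs_integral_mul_dirichletKernel_le {F : ℝ → ℝ} {A w : ℝ} (hF : Continuous F)
    (hw0 : 0 ≤ w) (hw1 : w ≤ 1) (hb : ∀ t ∈ Set.Icc 0 w, |F t| ≤ A)
    (hz : ∀ t ∈ Set.Icc w 1, F t = 0) (n : ℕ) :
    |∫ t in (0 : ℝ)..1, F t * dirichletKernel n t| ≤ A * (2 * n + 1) * w := by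
  have hc : Continuous fun t => F t * dirichletKernel n t := hF.mul (continuous_dirichletKernel n)
  have hA : 0 ≤ A := (abs_nonneg _).trans (hb 0 ⟨le_rfl, hw0⟩)
  rw [← intervalIntegral.integral_add_adjacent_intervals (hc.intervalIntegrable 0 w)
    (hc.intervalIntegrable w 1)]
  have : ∫ t in w..1, F t * dirichletKernel n t = ∫ t in w..1, (0 : ℝ) := by
    apply intervalIntegral.integral_congr
    intro t ht
    rw [Set.uIcc_of_le hw1] at ht
    simp [hz t ht]
  rw [this, intervalIntegral.integral_zero, add_zero, ← Real.norm_eq_abs]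
  refine (intervalIntegral.norm_integral_le_of_norm_le_const (C := A * (2 * n + 1))
    fun t ht => ?_).trans_eq ?_
  · rw [Set.uIoc_of_le hw0] at ht
    rw [norm_mul]
    exact mul_le_mul (hb t (Set.Ioc_subset_Icc_self ht)) (abs_dirichletKernel_le n t)
      (norm_nonneg _) hA
  · rw [sub_zero, abs_of_nonneg hw0]

/-- The bumps of index less than `k` do not contribute to the partial sums of order at least `2 ^ m`,
if `2 ^ (-m)` is the crossing of index `k` and the values at `2 ^ (-i)` do not decrease too fast. -/
lemma abs_integral_sum_bumpAt_le (hg : IsHomeoOf U g) {v : ℝ} (hv0 : 0 ≤ v) (hv1 : v < 1)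
    (hgv : 1 / 2 ≤ g v) {k m n : ℕ} (hk : k ≠ 0) (hkm : k ≤ m)
    (hu : dyadicValue U (m - k) 1 ≤ 2 ^ k ^ 3 * scale k) (hn : 2 ^ m ≤ n) :
    |∫ t in (0 : ℝ)..1, (∑ j ∈ Finset.range k, bumpAt j (g t)) * dirichletKernel n t| ≤
      14 * (k ^ 2 * (1 / 2) ^ k) * (1 + (1 - v)⁻¹) := by
  have hgc := hg.cont
  have hDc := continuous_dirichletKernel n
  simp only [Finset.sum_mul]
  rw [intervalIntegral.integral_finsetSum fun j _ => by
    exact (((continuous_bumpAt j).comp hgc).mul hDc).intervalIntegrable _ _]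
  have hv' : 0 < 1 - v := by linarith
  have hterm : ∀ j ∈ Finset.range k, |∫ t in (0 : ℝ)..1, bumpAt j (g t) * dirichletKernel n t| ≤
      14 * (k * (1 / 2) ^ k) * (1 + (1 - v)⁻¹) := by
    intro j hj
    have hjk := Finset.mem_range.1 hj
    set u : ℝ := (1 / 2) ^ (m - k) with hu'
    have hgu : g u ≤ scale j / 2 ^ octaves j := by
      rw [hu', hg.spine]
      exact hu.trans (scale_gap hjk)
    have hjhalf : scale j ≤ 1 / 2 := (scale_anti (Nat.zero_le j)).trans_eq scale_zero
    have huv : u ≤ v := by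
      by_contra h
      have h1 := hg.mono ⟨hv0, hv1.le⟩ (half_pow_mem (m - k)) (not_le.1 h)
      have h2 : scale j / 2 ^ octaves j ≤ scale j := div_two_pow_le (scale_pos j)
      linarith
    refine (abs_integral_bump_comp_mul_dirichletKernel_le (scale_pos j) (one_le_octaves j) hg.cont
      hg.mono (by positivity) hv1 huv hgu (hjhalf.trans hgv) n).trans ?_
    have hM : (2 : ℝ) ^ octaves j ≤ 2 * k := by
      have h1 : 2 ^ octaves j ≤ 2 ^ octaves k :=
        Nat.pow_le_pow_right (by norm_num) (octaves_mono hjk.le)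
      exact_mod_cast h1.trans (two_pow_octaves_le hk)
    have hn' : (2 * (n : ℝ) + 1)⁻¹ ≤ (1 / 2) ^ m := by
      rw [one_div, inv_pow]
      apply inv_anti₀ (by positivity)
      have : (2 : ℝ) ^ m ≤ n := by exact_mod_cast hn
      have : (0 : ℝ) ≤ n := by positivity
      linarith
    have hui : (1 / 2 : ℝ) ^ m * u⁻¹ = (1 / 2) ^ k := by
      rw [hu', ← Nat.sub_add_cancel hkm, pow_add, Nat.add_sub_cancel]
      field_simp
    have hmk : (1 / 2 : ℝ) ^ m ≤ (1 / 2) ^ k :=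
      pow_le_pow_of_le_one (by norm_num) (by norm_num) hkm
    have hfin : (2 * (n : ℝ) + 1)⁻¹ * (u⁻¹ + (1 - v)⁻¹) ≤ (1 / 2) ^ k * (1 + (1 - v)⁻¹) := by
      calc (2 * (n : ℝ) + 1)⁻¹ * (u⁻¹ + (1 - v)⁻¹) ≤ (1 / 2) ^ m * (u⁻¹ + (1 - v)⁻¹) :=
            mul_le_mul_of_nonneg_right hn' (by positivity)
        _ = (1 / 2) ^ k + (1 / 2) ^ m * (1 - v)⁻¹ := by rw [mul_add, hui]
        _ ≤ (1 / 2) ^ k + (1 / 2) ^ k * (1 - v)⁻¹ := by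
            have := mul_le_mul_of_nonneg_right hmk (inv_nonneg.2 hv'.le)
            linarith
        _ = _ := by ring
    calc 7 * 2 ^ octaves j * ((2 * (n : ℝ) + 1)⁻¹ * (u⁻¹ + (1 - v)⁻¹))
        ≤ 7 * (2 * k) * ((1 / 2) ^ k * (1 + (1 - v)⁻¹)) := by gcongr
      _ = _ := by ring
  refine (Finset.abs_sum_le_sum_abs _ _).trans ((Finset.sum_le_sum hterm).trans_eq ?_)
  rw [Finset.sum_const, Finset.card_range, nsmul_eq_mul]
  ring

lemma integral_bumpSum_eq (hg : Continuous g) (k n : ℕ) :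
    ∫ t in (0 : ℝ)..1, bumpSum (g t) * dirichletKernel n t =
      (∫ t in (0 : ℝ)..1, (∑ j ∈ Finset.range k, bumpAt j (g t)) * dirichletKernel n t) +
        ∫ t in (0 : ℝ)..1, bumpTail k (g t) * dirichletKernel n t := by
  have hDc := continuous_dirichletKernel n
  rw [← intervalIntegral.integral_add]
  · congr 1
    ext t
    rw [bumpTail]
    ring
  · exact ((by fun_prop : Continuous fun t => ∑ j ∈ Finset.range k, bumpAt j (g t)).mul
      hDc).intervalIntegrable _ _
  · exact ((by fun_prop : Continuous fun t => bumpTail k (g t)).mul hDc).intervalIntegrable _ _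

/-- The partial sum of order `2 ^ m` does not resolve the oscillation below `2 ^ (-m)`. -/
lemma abs_integral_bumpTail_le (hg : IsHomeoOf U g) {k m : ℕ} (hm : 1 ≤ m)
    (hc : IsCrossing U k m) :
    |∫ t in (0 : ℝ)..1, bumpTail k (g t) * dirichletKernel (2 ^ m) t| ≤ 6 / octaves k := by
  have hgc := hg.cont
  obtain ⟨m, rfl⟩ := Nat.exists_eq_add_of_le' hm
  refine (abs_integral_mul_dirichletKernel_le (A := 1 / octaves k) (w := (1 / 2) ^ m)
    (by fun_prop : Continuous fun t => bumpTail k (g t)) (half_pow_mem m).1 (half_pow_mem m).2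
    (fun t _ => abs_bumpTail_le k _) (fun t ht => ?_) _).trans ?_
  · apply bumpTail_of_ge
    have h1 := hc.1 m (Nat.lt_succ_self m)
    have h2 := hg.mono.monotoneOn (half_pow_mem m) ⟨(half_pow_mem m).1.trans ht.1, ht.2⟩ ht.1
    rw [hg.spine] at h2
    linarith [scale_pos k]
  · have e : (2 : ℝ) ^ m * (1 / 2) ^ m = 1 := by rw [← mul_pow]; norm_num
    have h := (half_pow_mem m).2
    have hM := octaves_pos k
    have e2 : 1 / (octaves k : ℝ) * (2 * ((2 ^ (m + 1) : ℕ) : ℝ) + 1) * (1 / 2) ^ m =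
        (4 + (1 / 2) ^ m) / octaves k := by
      push_cast
      rw [pow_succ]
      have : (2 * ((2 : ℝ) ^ m * 2) + 1) * (1 / 2) ^ m = 4 + (1 / 2) ^ m := by linarith
      rw [mul_assoc, this]
      ring
    rw [e2]
    exact div_le_div_of_nonneg_right (by linarith) hM.le

/-- Under a linear function the `k`th bump resonates with the Dirichlet kernel. -/
lemma integral_bumpAt_linear_ge (k p : ℕ) (hp : 2 ≤ p) :
    1 / (8 * Real.pi) - 1 / octaves k ≤ ∫ t in (0 : ℝ)..1,
      bumpAt k (scale k * (2 ^ p * t)) * dirichletKernel (2 ^ (p + octaves k)) t := by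
  set M := octaves k with hM
  set n := 2 ^ (p + M) with hn
  have hM0 : (0 : ℝ) < M := octaves_pos k
  have hs := scale_pos k
  have hc : Continuous fun t => bumpAt k (scale k * (2 ^ p * t)) * dirichletKernel n t :=
    (by fun_prop : Continuous fun t : ℝ => bumpAt k (scale k * (2 ^ p * t))).mul
      (continuous_dirichletKernel n)
  have hpow : (2 : ℝ) ^ p * (1 / 2) ^ p = 1 := by rw [← mul_pow]; norm_num
  have hpowM : (2 : ℝ) ^ M * (1 / 2) ^ M = 1 := by rw [← mul_pow]; norm_num
  have hpM : (1 / 2 : ℝ) ^ (p + M) = (1 / 2) ^ p * (1 / 2) ^ M := pow_add _ _ _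
  have h01 : (0 : ℝ) ≤ (1 / 2) ^ (p + M) := by positivity
  have h12 : (1 / 2 : ℝ) ^ (p + M) ≤ (1 / 2) ^ p :=
    pow_le_pow_of_le_one (by norm_num) (by norm_num) (by omega)
  have h23 : (1 / 2 : ℝ) ^ p ≤ 1 := (half_pow_mem p).2
  have hsd : scale k / 2 ^ M = scale k * (1 / 2) ^ M := by
    rw [one_div, inv_pow, div_eq_mul_inv]
  rw [← intervalIntegral.integral_add_adjacent_intervals
    (hc.intervalIntegrable 0 ((1 / 2) ^ (p + M))) (hc.intervalIntegrable _ 1),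
    ← intervalIntegral.integral_add_adjacent_intervals
    (hc.intervalIntegrable ((1 / 2) ^ (p + M)) ((1 / 2) ^ p)) (hc.intervalIntegrable _ 1)]
  have e1 : ∫ t in (0 : ℝ)..(1 / 2) ^ (p + M),
      bumpAt k (scale k * (2 ^ p * t)) * dirichletKernel n t = 0 := by
    refine (intervalIntegral.integral_congr (g := fun _ => (0 : ℝ)) ?_).trans
      intervalIntegral.integral_zero
    intro t ht
    rw [Set.uIcc_of_le h01] at ht
    simp only
    rw [bumpAt_of_le, zero_mul]
    rw [← hM, hsd]
    apply mul_le_mul_of_nonneg_left _ hs.le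
    calc (2 : ℝ) ^ p * t ≤ 2 ^ p * (1 / 2) ^ (p + M) :=
          mul_le_mul_of_nonneg_left ht.2 (by positivity)
      _ = (1 / 2) ^ M := by rw [hpM, ← mul_assoc, hpow, one_mul]
  have e3 : ∫ t in ((1 / 2 : ℝ) ^ p)..1,
      bumpAt k (scale k * (2 ^ p * t)) * dirichletKernel n t = 0 := by
    refine (intervalIntegral.integral_congr (g := fun _ => (0 : ℝ)) ?_).trans
      intervalIntegral.integral_zero
    intro t ht
    rw [Set.uIcc_of_le h23] at ht
    simp only
    rw [bumpAt_of_ge, zero_mul]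
    apply le_mul_of_one_le_right hs.le
    rw [← hpow]
    exact mul_le_mul_of_nonneg_left ht.1 (by positivity)
  have e2 : ∫ t in ((1 / 2 : ℝ) ^ (p + M))..((1 / 2) ^ p),
      bumpAt k (scale k * (2 ^ p * t)) * dirichletKernel n t =
      (∫ t in ((1 / 2 : ℝ) ^ (p + M))..((1 / 2) ^ p),
        Real.sin (2 * Real.pi * (2 ^ (p + M) : ℕ) * t) * dirichletKernel (2 ^ (p + M)) t) / M := by
    rw [← intervalIntegral.integral_div]
    apply intervalIntegral.integral_congr
    intro t ht
    rw [Set.uIcc_of_le h12] at ht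
    simp only
    rw [bumpAt, bump_of_mem, ← hM]
    · have : 2 * Real.pi * 2 ^ M / scale k * (scale k * (2 ^ p * t)) =
          2 * Real.pi * (2 ^ (p + M) : ℕ) * t := by
        push_cast
        rw [pow_add]
        field_simp
      rw [this]
      ring
    · rw [← hM, hsd]
      apply mul_le_mul_of_nonneg_left _ hs.le
      calc ((1 : ℝ) / 2) ^ M = 2 ^ p * (1 / 2) ^ (p + M) := by rw [hpM, ← mul_assoc, hpow, one_mul]
        _ ≤ _ := mul_le_mul_of_nonneg_left ht.1 (by positivity)
    · apply mul_le_of_le_one_right hs.le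
      rw [← hpow]
      exact mul_le_mul_of_nonneg_left ht.2 (by positivity)
  rw [e1, e3, e2, zero_add, add_zero]
  have := integral_sin_mul_dirichletKernel_ge p M hp
  rw [le_div_iff₀ hM0, sub_mul, one_div_mul_cancel hM0.ne']
  calc 1 / (8 * Real.pi) * M - 1 = M / (8 * Real.pi) - 1 := by ring
    _ ≤ _ := this

/-- At a favourable crossing the partial sum of order `2 ^ (m + 1 + octaves k)` picks up a
contribution of the `k`th bump that is bounded below. -/
lemma integral_bumpTail_ge (hg : IsHomeoOf U g) {k m : ℕ} (hm : 1 ≤ m)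
    (hf : IsFavourable U k m) :
    1 / (8 * Real.pi) - 216 / octaves k ≤ ∫ t in (0 : ℝ)..1,
      bumpTail k (g t) * dirichletKernel (2 ^ (m + 1 + octaves k)) t := by
  have hgc := hg.cont
  set M := octaves k with hM
  set n := 2 ^ (m + 1 + M) with hn
  have hM0 : (0 : ℝ) < M := octaves_pos k
  have hM1 : (1 : ℝ) ≤ M := by exact_mod_cast one_le_octaves k
  have hs := scale_pos k
  have hDc := continuous_dirichletKernel n
  set e : ℝ := (1 / 2) ^ M with he
  have he0 : 0 < e := by positivity
  have hMe : (2 : ℝ) ^ M * e = 1 := by rw [he, ← mul_pow]; norm_num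
  have hmm : (2 : ℝ) ^ m * (1 / 2) ^ m = 1 := by rw [← mul_pow]; norm_num
  have heM : e ≤ 1 / M := by
    rw [le_div_iff₀ hM0, ← hMe, mul_comm]
    apply mul_le_mul_of_nonneg_right _ he0.le
    exact_mod_cast Nat.lt_two_pow_self.le
  have he1 : e ≤ 1 / 2 := by
    rw [he]
    calc (1 / 2 : ℝ) ^ M ≤ (1 / 2) ^ 1 :=
          pow_le_pow_of_le_one (by norm_num) (by norm_num) (one_le_octaves k)
      _ = 1 / 2 := pow_one _
  have hdepth : (1 / 2 : ℝ) ^ depth k = e ^ 4 := by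
    rw [depth, he, ← pow_mul, mul_comm]
  have he4 : e ^ 4 ≤ e / 8 := by
    have h2 : e ^ 2 ≤ 1 / 4 := by nlinarith
    have h3 : e ^ 3 ≤ 1 / 8 := by nlinarith
    nlinarith
  have hnr : (n : ℝ) = 2 ^ m * (2 * 2 ^ M) := by
    rw [hn]; push_cast; rw [pow_add, pow_add]; ring
  have hn5 : (2 * (n : ℝ) + 1) * (1 / 2) ^ m ≤ 5 * 2 ^ M := by
    have h1 : (1 / 2 : ℝ) ^ m ≤ 1 := (half_pow_mem m).2
    have h2 : (1 : ℝ) ≤ 2 ^ M := one_le_pow₀ (by norm_num)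
    calc (2 * (n : ℝ) + 1) * (1 / 2) ^ m = 4 * 2 ^ M * (2 ^ m * (1 / 2) ^ m) + (1 / 2) ^ m := by
          rw [hnr]; ring
      _ ≤ _ := by rw [hmm]; linarith
  -- the values beyond `2 ^ (-m)` are outside the supports
  have hbeyond : ∀ t ∈ Set.Icc ((1 / 2 : ℝ) ^ m) 1, scale k ≤ g t := by
    intro t ht
    have h2 := hg.mono.monotoneOn (half_pow_mem m) ⟨(half_pow_mem m).1.trans ht.1, ht.2⟩ ht.1
    rw [hg.spine] at h2
    have h3 := hf.2.1
    rw [hdepth] at h3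
    nlinarith
  have hmain := integral_bumpAt_linear_ge k (m + 1) (by omega)
  rw [← hM, ← hn] at hmain
  have hlin : |∫ t in (0 : ℝ)..1, (bumpAt k (g t) - bumpAt k (scale k * (2 ^ (m + 1) * t))) *
      dirichletKernel n t| ≤ 210 * e := by
    refine (abs_integral_mul_dirichletKernel_le (A := 42 * e ^ 2) (w := (1 / 2) ^ m)
      (by fun_prop) (half_pow_mem m).1 (half_pow_mem m).2 (fun t ht => ?_) (fun t ht => ?_)
      n).trans ?_
    · have h1 := abs_sub_linear_le hg hf ht.1 ht.2
      rw [hdepth] at h1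
      refine (abs_bump_sub_le hs (one_le_octaves k) _ _).trans ?_
      rw [← hM, show scale k * (2 ^ (m + 1) * t) = 2 * scale k * (2 ^ m * t) by ring]
      calc 7 * (scale k / 2 ^ M)⁻¹ * |g t - 2 * scale k * (2 ^ m * t)|
          ≤ 7 * (scale k / 2 ^ M)⁻¹ * (3 * e ^ 4 * (2 * scale k)) := by gcongr
        _ = 42 * e ^ 3 * (2 ^ M * e) := by field_simp; ring
        _ ≤ 42 * e ^ 2 := by
          rw [hMe]
          nlinarith [sq_nonneg e]
    · rw [bumpAt_of_ge (hbeyond t ht), bumpAt_of_ge, sub_zero]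
      have : (1 : ℝ) ≤ 2 ^ m * t := by
        rw [← hmm]
        exact mul_le_mul_of_nonneg_left ht.1 (by positivity)
      rw [pow_succ]
      nlinarith
    · calc 42 * e ^ 2 * (2 * (n : ℝ) + 1) * (1 / 2) ^ m
          = 42 * e ^ 2 * ((2 * (n : ℝ) + 1) * (1 / 2) ^ m) := by ring
        _ ≤ 42 * e ^ 2 * (5 * 2 ^ M) := mul_le_mul_of_nonneg_left hn5 (by positivity)
        _ = 210 * e * (2 ^ M * e) := by ring
        _ = 210 * e := by rw [hMe, mul_one]
  have htail : |∫ t in (0 : ℝ)..1, bumpTail (k + 1) (g t) * dirichletKernel n t| ≤ 5 / M := by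
    have hwle : (1 / 2 : ℝ) ^ m * e ≤ (1 / 2) ^ m :=
      mul_le_of_le_one_right (by positivity) (by linarith)
    have hM' : (1 : ℝ) / octaves (k + 1) ≤ 1 / M := by
      apply one_div_le_one_div_of_le hM0
      exact_mod_cast octaves_mono (Nat.le_succ k)
    refine (abs_integral_mul_dirichletKernel_le (A := 1 / M) (w := (1 / 2) ^ m * e)
      (by fun_prop : Continuous fun t => bumpTail (k + 1) (g t)) (by positivity)
      (hwle.trans (half_pow_mem m).2) (fun t _ => (abs_bumpTail_le _ _).trans hM')
      (fun t ht => ?_) n).trans ?_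
    · apply bumpTail_of_ge
      rcases le_total t ((1 / 2) ^ m) with htm | htm
      · have ht0 : 0 ≤ t := le_trans (by positivity) ht.1
        have h1 := (abs_le.1 (abs_sub_linear_le hg hf ht0 htm)).1
        rw [hdepth] at h1
        have h2 : e ≤ 2 ^ m * t := by
          calc e = 2 ^ m * ((1 / 2) ^ m * e) := by rw [← mul_assoc, hmm, one_mul]
            _ ≤ _ := mul_le_mul_of_nonneg_left ht.1 (by positivity)
        have h3 : scale (k + 1) ≤ scale k * e := by
          refine (scale_le_of_lt (Nat.lt_succ_self k)).trans_eq ?_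
          rw [he, one_div, inv_pow, div_eq_mul_inv]
        have h4 : scale k * e ≤ scale k * (2 ^ m * t) := mul_le_mul_of_nonneg_left h2 hs.le
        have h5 : scale k * e ^ 4 ≤ scale k * (e / 8) := mul_le_mul_of_nonneg_left he4 hs.le
        have h6 : 0 < scale k * e := mul_pos hs he0
        linarith
      · exact (scale_anti (Nat.le_succ k)).trans (hbeyond t ⟨htm, ht.2⟩)
    · calc 1 / (M : ℝ) * (2 * n + 1) * ((1 / 2) ^ m * e)
          = 1 / (M : ℝ) * e * ((2 * n + 1) * (1 / 2) ^ m) := by ring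
        _ ≤ 1 / (M : ℝ) * e * (5 * 2 ^ M) := mul_le_mul_of_nonneg_left hn5 (by positivity)
        _ = 5 / M * (2 ^ M * e) := by ring
        _ = 5 / M := by rw [hMe, mul_one]
  have hsplit : ∫ t in (0 : ℝ)..1, bumpTail k (g t) * dirichletKernel n t =
      (∫ t in (0 : ℝ)..1, bumpAt k (scale k * (2 ^ (m + 1) * t)) * dirichletKernel n t) +
      (∫ t in (0 : ℝ)..1, (bumpAt k (g t) - bumpAt k (scale k * (2 ^ (m + 1) * t))) *
        dirichletKernel n t) +
      ∫ t in (0 : ℝ)..1, bumpTail (k + 1) (g t) * dirichletKernel n t := by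
    rw [← intervalIntegral.integral_add, ← intervalIntegral.integral_add]
    · congr 1
      ext t
      rw [bumpTail_succ]
      ring
    · exact (by fun_prop : Continuous _).intervalIntegrable _ _
    · exact (by fun_prop : Continuous _).intervalIntegrable _ _
    · exact (by fun_prop : Continuous _).intervalIntegrable _ _
    · exact (by fun_prop : Continuous _).intervalIntegrable _ _
  rw [hsplit]
  have e216 : (216 : ℝ) / M = 1 / M + 210 * (1 / M) + 5 / M := by ring
  have a1 := (abs_le.1 hlin).1
  have a2 := (abs_le.1 htail).1
  linarith

lemma IsCrossing.of_decay (hg : IsHomeoOf U g) {k m : ℕ} (hk : k ≠ 0) (hc : IsCrossing U k m)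
    (hdecay : ∀ m, 2 ^ k ^ 3 * scale k ≤ dyadicValue U m 1 →
      2 * scale k < dyadicValue U (m + k) 1) :
    k < m ∧ dyadicValue U (m - k) 1 ≤ 2 ^ k ^ 3 * scale k := by
  have hkm : k < m := by
    have h1 : 2 ^ k ^ 3 * scale k ≤ dyadicValue U 0 1 := by
      rw [spine_zero]
      refine (scale_gap (Nat.pos_of_ne_zero hk)).trans ((div_two_pow_le (scale_pos 0)).trans ?_)
      rw [scale_zero]
      norm_num
    have h2 := hdecay 0 h1
    rw [zero_add] at h2
    by_contra h
    have := spine_anti hg.mem (not_lt.1 h)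
    simp only at this
    linarith [hc.2]
  refine ⟨hkm, ?_⟩
  by_contra h
  have := hdecay (m - k) (not_le.1 h).le
  rw [Nat.sub_add_cancel hkm.le] at this
  linarith [hc.2]

/-- The partial sums do not converge: along the orders `2 ^ m`, with `2 ^ (-m)` a crossing, they tend
to `0`, while favourable crossings give partial sums bounded below. -/
theorem not_tendsto_integral_bumpSum (hg : IsHomeoOf U g)
    (hdecay : ∀ᶠ k in atTop, ∀ m, 2 ^ k ^ 3 * scale k ≤ dyadicValue U m 1 →
      2 * scale k < dyadicValue U (m + k) 1)
    (hcross : ∀ k, ∃ m, IsCrossing U k m) (hfav : ∃ᶠ k in atTop, ∃ m, IsFavourable U k m) :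
    ¬ ∃ L : ℝ, Tendsto (fun n : ℕ => ∫ t in (0 : ℝ)..1, bumpSum (g t) * dirichletKernel n t)
      atTop (𝓝 L) := by
  rintro ⟨L, hL⟩
  have hg0 : g 0 = 0 := by simpa using hg.val 0 0 (by simp)
  have hg1 : g 1 = 1 := by simpa [dyadicValue] using hg.val 0 1 (by simp)
  obtain ⟨v, hv, hgv⟩ : (1 / 2 : ℝ) ∈ g '' Set.Icc 0 1 :=
    intermediate_value_Icc zero_le_one hg.cont.continuousOn (by rw [hg0, hg1]; norm_num)
  have hv1 : v < 1 := lt_of_le_of_ne hv.2 fun h => by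
    rw [h, hg1] at hgv
    norm_num at hgv
  set C : ℝ := 1 + (1 - v)⁻¹
  have hk2 : Tendsto (fun k : ℕ => 14 * ((k : ℝ) ^ 2 * (1 / 2) ^ k) * C) atTop (𝓝 0) := by
    have := tendsto_pow_const_mul_const_pow_of_abs_lt_one 2
      (show |(1 / 2 : ℝ)| < 1 by rw [abs_of_pos] <;> norm_num)
    simpa using (this.const_mul 14).mul_const C
  have hM : ∀ A : ℝ, Tendsto (fun k : ℕ => A / octaves k) atTop (𝓝 0) := fun A =>
    (tendsto_natCast_atTop_atTop.comp tendsto_octaves).const_div_atTop A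
  choose τ hτ using hcross
  have hτk : ∀ᶠ k in atTop, k < τ k := by
    filter_upwards [hdecay, eventually_ne_atTop 0] with k hk hk0
    exact ((hτ k).of_decay hg hk0 hk).1
  have hτtop : Tendsto (fun k => 2 ^ τ k) atTop atTop := by
    refine tendsto_atTop_mono' atTop (hτk.mono fun k hk => ?_) tendsto_id
    exact hk.le.trans Nat.lt_two_pow_self.le
  -- the limit along the crossings is `0`
  have hL0 : L = 0 := by
    refine tendsto_nhds_unique (hL.comp hτtop) ?_
    have h0 := hk2.add (hM 6)
    rw [add_zero] at h0
    refine squeeze_zero_norm' ?_ h0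
    filter_upwards [hdecay, eventually_ne_atTop 0] with k hk hk0
    obtain ⟨h1, h2⟩ := (hτ k).of_decay hg hk0 hk
    rw [Function.comp_apply, integral_bumpSum_eq hg.cont k, Real.norm_eq_abs]
    refine (abs_add_le _ _).trans (add_le_add ?_ ?_)
    · exact abs_integral_sum_bumpAt_le hg hv.1 hv1 hgv.ge hk0 h1.le h2 le_rfl
    · exact abs_integral_bumpTail_le hg (by omega) (hτ k)
  rw [hL0] at hL
  have hsmall : ∀ᶠ n in atTop, ∫ t in (0 : ℝ)..1, bumpSum (g t) * dirichletKernel n t < 1 / 100 :=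
    hL.eventually_lt_const (by norm_num)
  obtain ⟨N, hN⟩ := eventually_atTop.1 hsmall
  have h100 : (1 : ℝ) / 100 > 0 := by norm_num
  obtain ⟨k, ⟨m, hm⟩, hk, hk0, h14, h216⟩ := (hfav.and_eventually (hdecay.and
    ((eventually_ge_atTop (N + 1)).and ((hk2.eventually_lt_const h100).and
      ((hM 216).eventually_lt_const h100))))).exists
  obtain ⟨h1, h2⟩ := hm.1.of_decay hg (by omega) hk
  have hmn : 2 ^ m ≤ 2 ^ (m + 1 + octaves k) := Nat.pow_le_pow_right (by norm_num) (by omega)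
  have a1 := hN (2 ^ (m + 1 + octaves k))
    ((by omega : N ≤ m).trans (Nat.lt_two_pow_self.le.trans hmn))
  rw [integral_bumpSum_eq hg.cont k] at a1
  have a2 := (abs_le.1 (abs_integral_sum_bumpAt_le hg hv.1 hv1 hgv.ge (by omega) h1.le h2 hmn)).1
  have a3 := integral_bumpTail_ge hg (by omega) hm
  have a4 : (3 : ℝ) / 100 < 1 / (8 * Real.pi) := by
    rw [div_lt_div_iff₀ (by norm_num) (by positivity)]
    linarith [Real.pi_lt_d2]
  linarith

end composition

/-! ### The Fourier partial sums as integrals -/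

lemma compHomeo_coe (φ : unitInterval ≃ₜ unitInterval) {x : ℝ} (hx : x ∈ Set.Ico (0 : ℝ) 1) :
    compHomeo circleBump φ (x : UnitAddCircle) =
      ((bumpSum (φ (Set.projIcc 0 1 zero_le_one x) : unitInterval) : ℝ) : ℂ) := by
  rw [compHomeo, AddCircle.liftIco_coe_apply (p := 1) (a := 0) (by rwa [zero_add])]
  have h := (φ (Set.projIcc 0 1 zero_le_one x)).2
  rw [circleBump_coe ⟨by linarith [h.1], h.2⟩]

/-- The real part of the partial sum at `0` is the integral against the Dirichlet kernel. -/
lemma re_fourierPartialSum (φ : unitInterval ≃ₜ unitInterval) (n : ℕ) :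
    (fourierPartialSum (compHomeo circleBump φ) n 0).re =
      ∫ t in (0 : ℝ)..1, bumpSum (φ (Set.projIcc 0 1 zero_le_one t) : unitInterval) *
        dirichletKernel n t := by
  set g : ℝ → ℝ := fun t => (φ (Set.projIcc 0 1 zero_le_one t) : unitInterval) with hg
  have hgc : Continuous g :=
    continuous_subtype_val.comp (φ.continuous.comp continuous_projIcc)
  have hterm : ∀ j : ℤ, (fourierCoeff (compHomeo circleBump φ) j).re =
      ∫ t in (0 : ℝ)..1, bumpSum (g t) * Real.cos (2 * Real.pi * j * t) := by
    intro j
    rw [fourierCoeff_eq_intervalIntegral _ j 0, zero_add, div_one, one_smul]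
    have h1 : ∫ x in (0 : ℝ)..1, (fourier (-j) (x : UnitAddCircle)) •
        compHomeo circleBump φ (x : UnitAddCircle) =
        ∫ x in (0 : ℝ)..1, fourier (-j) (x : UnitAddCircle) * ((bumpSum (g x) : ℝ) : ℂ) := by
      rw [intervalIntegral.integral_of_le zero_le_one, intervalIntegral.integral_of_le zero_le_one,
        integral_Ioc_eq_integral_Ioo, integral_Ioc_eq_integral_Ioo]
      refine setIntegral_congr_fun measurableSet_Ioo fun x hx => ?_
      simp only [smul_eq_mul]
      rw [compHomeo_coe φ ⟨hx.1.le, hx.2⟩]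
    have hc : Continuous fun x : ℝ =>
        fourier (-j) (x : UnitAddCircle) * ((bumpSum (g x) : ℝ) : ℂ) := by
      refine Continuous.mul ?_ (Complex.continuous_ofReal.comp (continuous_bumpSum.comp hgc))
      exact (map_continuous (fourier (-j))).comp (AddCircle.continuous_mk' 1)
    have h2 := Complex.reCLM.intervalIntegral_comp_comm (hc.intervalIntegrable (μ := volume) 0 1)
    rw [h1]
    simp only [Complex.reCLM_apply] at h2
    rw [← h2]
    apply intervalIntegral.integral_congr
    intro x _
    simp only
    rw [Complex.re_mul_ofReal, mul_comm, fourier_coe_apply]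
    congr 1
    have : (2 * (Real.pi : ℂ) * Complex.I * ((-j : ℤ) : ℂ) * (x : ℂ) / ((1 : ℝ) : ℂ)) =
        ((-(2 * Real.pi * j * x) : ℝ) : ℂ) * Complex.I := by
      push_cast
      ring
    rw [this, Complex.exp_ofReal_mul_I_re, Real.cos_neg]
  have hf0 : ∀ j : ℤ, fourier j (0 : UnitAddCircle) = (1 : ℂ) := fun j => by simp
  unfold fourierPartialSum
  simp only [hf0, mul_one, Complex.re_sum, hterm]
  rw [← intervalIntegral.integral_finsetSum fun j _ => by
    exact (by fun_prop : Continuous fun t : ℝ =>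
      bumpSum (g t) * Real.cos (2 * Real.pi * j * t)).intervalIntegrable _ _]
  simp only [dirichletKernel, Finset.mul_sum]
  rfl

lemma isHomeoOf_projIcc {U : DyadicIndex → ℝ} (hU : ∀ i, U i ∈ Set.Ioo (0 : ℝ) 1)
    {φ : unitInterval ≃ₜ unitInterval} (hφ : ExtendsDyadic U φ) (hmono : StrictMono φ) :
    IsHomeoOf U fun t => (φ (Set.projIcc 0 1 zero_le_one t) : unitInterval) where
  mem := hU
  cont := continuous_subtype_val.comp (φ.continuous.comp continuous_projIcc)
  mono s hs t ht hst := by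
    apply hmono
    rw [Set.projIcc_of_mem _ hs, Set.projIcc_of_mem _ ht]
    exact hst
  val n k hk := by
    have h : (k : ℝ) / 2 ^ n ∈ Set.Icc (0 : ℝ) 1 :=
      ⟨by positivity, (div_le_one (by positivity)).2 (by exact_mod_cast hk)⟩
    rw [Set.projIcc_of_mem _ h]
    exact hφ n k _ rfl

/-! ### Decay of the values at `2 ^ (-m)` -/

lemma spine_add_ge {U : DyadicIndex → ℝ} (hU : ∀ i, U i ∈ Set.Ioo (0 : ℝ) 1) {m : ℕ} {q : ℝ}
    (hq : 0 ≤ q) (l : ℕ) (h : ∀ i < l, q ≤ U (spineIndex (m + i))) :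
    dyadicValue U m 1 * q ^ l ≤ dyadicValue U (m + l) 1 := by
  induction l with
  | zero => simp
  | succ l ih =>
    rw [← add_assoc, spine_succ, pow_succ]
    calc dyadicValue U m 1 * (q ^ l * q) = q * (dyadicValue U m 1 * q ^ l) := by ring
      _ ≤ U (spineIndex (m + l)) * dyadicValue U (m + l) 1 := by
        apply mul_le_mul (h l (Nat.lt_succ_self l)) (ih fun i hi => h i (by omega)) _ (hU _).1.le
        exact mul_nonneg (spine_pos hU m).le (by positivity)

lemma eventually_three_mul_succ_pow_four_le : ∀ᶠ k : ℕ in atTop, 3 * (k + 1) ^ 4 ≤ 2 ^ k := by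
  have h := (tendsto_pow_const_mul_const_pow_of_abs_lt_one 4
    (show |(1 / 2 : ℝ)| < 1 by rw [abs_of_pos] <;> norm_num)).const_mul 48
  rw [mul_zero] at h
  filter_upwards [h.eventually_lt_const one_pos, eventually_ge_atTop 1] with k hk hk1
  have h1 : (48 : ℝ) * k ^ 4 ≤ 2 ^ k := by
    have h2 : (0 : ℝ) < 2 ^ k := by positivity
    rw [one_div, inv_pow, ← mul_assoc, ← div_eq_mul_inv, div_lt_one h2] at hk
    exact hk.le
  have h2 : 48 * k ^ 4 ≤ 2 ^ k := by exact_mod_cast h1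
  calc 3 * (k + 1) ^ 4 ≤ 3 * (2 * k) ^ 4 := by gcongr; omega
    _ = 48 * k ^ 4 := by ring
    _ ≤ _ := h2

/-- If the values `R m` at `2 ^ (-m)` are at most `2 ^ (-m / 2)` and their successive ratios at least
`1 / (m + 1) ^ 2`, then `R` needs many steps to pass from one support to the next. -/
lemma eventually_spine_decay {U : DyadicIndex → ℝ} (hU : ∀ i, U i ∈ Set.Ioo (0 : ℝ) 1)
    (hsq : ∀ᶠ m : ℕ in atTop, (2 : ℝ) ^ m * dyadicValue U m 1 ^ 2 ≤ 1)
    (hratio : ∀ᶠ m : ℕ in atTop, 1 / ((m : ℝ) + 1) ^ 2 ≤ U (spineIndex m)) :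
    ∀ᶠ k in atTop, ∀ m, 2 ^ k ^ 3 * scale k ≤ dyadicValue U m 1 →
      2 * scale k < dyadicValue U (m + k) 1 := by
  obtain ⟨m₀, hm₀⟩ := eventually_atTop.1 (hsq.and hratio)
  have hc0 : Tendsto (fun k : ℕ => 2 ^ k ^ 3 * scale k) atTop (𝓝 0) := by
    refine squeeze_zero' (g := fun k => scale (k - 1)) (.of_forall fun k => ?_) ?_ ?_
    · have := scale_pos k; positivity
    · filter_upwards [eventually_ge_atTop 1] with k hk
      exact (scale_gap (by omega : k - 1 < k)).trans (div_two_pow_le (scale_pos _))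
    · exact tendsto_scale.comp (tendsto_sub_atTop_nat 1)
  filter_upwards [hc0.eventually_le_const (spine_pos hU m₀), eventually_three_mul_succ_pow_four_le,
    eventually_ge_atTop 3] with k hk hk4 hk3 m hm
  set m' := max m m₀ with hm'
  have hm'0 : m₀ ≤ m' := le_max_right _ _
  have hcm : 2 ^ k ^ 3 * scale k ≤ dyadicValue U m' 1 := by
    rcases max_choice m m₀ with h | h
    · rw [hm', h]; exact hm
    · rw [hm', h]; exact hk
  have hs := scale_pos k
  -- the bound on the value bounds the level
  have hlevel : m' ≤ 2 * (k + 1) ^ 4 := by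
    have h1 : scale k ≤ dyadicValue U m' 1 :=
      (le_mul_of_one_le_left hs.le (one_le_pow₀ (by norm_num))).trans hcm
    have h2 : (2 : ℝ) ^ m' * scale k ^ 2 ≤ 1 :=
      (mul_le_mul_of_nonneg_left (pow_le_pow_left₀ hs.le h1 2) (by positivity)).trans
        (hm₀ m' hm'0).1
    have h3 : scale k ^ 2 = ((2 : ℝ) ^ (2 * (k + 1) ^ 4))⁻¹ := by
      rw [scale, ← pow_mul, one_div, inv_pow, mul_comm]
    rw [h3, ← div_eq_mul_inv, div_le_one (by positivity)] at h2
    exact (pow_le_pow_iff_right₀ (by norm_num : (1 : ℝ) < 2)).1 h2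
  have hlev2 : m' + k ≤ 2 ^ k := by
    have : k ≤ (k + 1) ^ 4 := (Nat.le_succ k).trans (Nat.le_self_pow (by norm_num) _)
    omega
  have hq : ∀ i < k, ((1 / 2 : ℝ) ^ (2 * k)) ≤ U (spineIndex (m' + i)) := by
    intro i hi
    refine le_trans ?_ (hm₀ (m' + i) (by omega)).2
    rw [one_div_pow]
    apply one_div_le_one_div_of_le (by positivity)
    rw [mul_comm 2 k, pow_mul]
    apply pow_le_pow_left₀ (by positivity)
    exact_mod_cast (by omega : m' + i + 1 ≤ 2 ^ k)
  have h1 := spine_add_ge hU (by positivity) k hq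
  have h2 : dyadicValue U (m' + k) 1 ≤ dyadicValue U (m + k) 1 :=
    spine_anti hU (by simp [hm'])
  refine lt_of_lt_of_le ?_ (h1.trans h2)
  have h3 : 2 ^ k ^ 3 * scale k * ((1 / 2 : ℝ) ^ (2 * k)) ^ k ≤
      dyadicValue U m' 1 * ((1 / 2 : ℝ) ^ (2 * k)) ^ k :=
    mul_le_mul_of_nonneg_right hcm (by positivity)
  refine lt_of_lt_of_le ?_ h3
  have he : 2 * k * k + 2 ≤ k ^ 3 := by
    have h4 : 3 * (k * k) ≤ k * (k * k) := Nat.mul_le_mul_right _ hk3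
    have h5 : 3 * 3 ≤ k * k := Nat.mul_le_mul hk3 hk3
    calc 2 * k * k + 2 = 2 * (k * k) + 2 := by ring
      _ ≤ k * (k * k) := by omega
      _ = k ^ 3 := by ring
  obtain ⟨d, hd⟩ := Nat.exists_eq_add_of_le he
  rw [hd, ← pow_mul, one_div, inv_pow]
  have e : (2 : ℝ) ^ (2 * k * k + 2 + d) * scale k * (2 ^ (2 * k * k))⁻¹ =
      4 * 2 ^ d * scale k := by
    rw [pow_add, pow_add]
    field_simp
    norm_num
  rw [e]
  have : (1 : ℝ) ≤ 2 ^ d := one_le_pow₀ (by norm_num)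
  nlinarith

/-! ### Independent uniform parameters: almost sure regularity -/

/-- The uniform distribution on `[0, 1]`. -/
noncomputable def uniformLaw : Measure ℝ := volume.restrict (Set.Icc (0 : ℝ) 1)

instance : IsProbabilityMeasure uniformLaw := ⟨by simp [uniformLaw]⟩

/-- The joint law of independent uniform parameters. -/
noncomputable def paramLaw : Measure (DyadicIndex → ℝ) := Measure.infinitePi fun _ => uniformLaw

instance : IsProbabilityMeasure paramLaw := by unfold paramLaw; infer_instance

/-- The σ-algebra generated by the parameters with index in `S`. -/
@[reducible]
def sigmaOf (S : Set DyadicIndex) : MeasurableSpace (DyadicIndex → ℝ) :=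
  ⨆ i ∈ S, MeasurableSpace.comap (fun U : DyadicIndex → ℝ => U i) inferInstance

/-- The indices of level at most `n`. -/
def levelLE (n : ℕ) : Set DyadicIndex := {i | i.1.1 ≤ n}

lemma sigmaOf_le (S : Set DyadicIndex) : sigmaOf S ≤ MeasurableSpace.pi :=
  iSup₂_le fun i _ => (measurable_pi_apply i).comap_le

lemma sigmaOf_mono {S T : Set DyadicIndex} (h : S ⊆ T) : sigmaOf S ≤ sigmaOf T :=
  biSup_mono h

lemma measurable_eval_sigmaOf {S : Set DyadicIndex} {i : DyadicIndex} (hi : i ∈ S) :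
    Measurable[sigmaOf S] fun U : DyadicIndex → ℝ => U i :=
  (comap_measurable _).mono (le_iSup₂_of_le i hi le_rfl) le_rfl

lemma indep_sigmaOf {S T : Set DyadicIndex} (h : Disjoint S T) :
    Indep (sigmaOf S) (sigmaOf T) paramLaw := by
  refine indep_iSup_of_disjoint (fun i => (measurable_pi_apply i).comap_le) ?_ h
  exact iIndepFun_infinitePi (P := fun _ : DyadicIndex => uniformLaw) (X := fun _ x => x)
    fun _ => measurable_id

lemma measurable_dyadicValue (n k : ℕ) :
    Measurable[sigmaOf (levelLE n)] fun U => dyadicValue U n k := by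
  induction n generalizing k with
  | zero => simp only [dyadicValue]; exact measurable_const
  | succ n ih =>
    have hle : sigmaOf (levelLE n) ≤ sigmaOf (levelLE (n + 1)) :=
      sigmaOf_mono fun i (hi : i.1.1 ≤ n) => Nat.le_succ_of_le hi
    have ih' : ∀ k, Measurable[sigmaOf (levelLE (n + 1))] fun U => dyadicValue U n k :=
      fun k => (ih k).mono hle le_rfl
    simp only [dyadicValue]
    split_ifs with h
    · exact (ih' _).add ((measurable_eval_sigmaOf (le_refl (n + 1))).mul ((ih' _).sub (ih' _)))
    · exact ih' _

lemma map_eval_paramLaw (i : DyadicIndex) : paramLaw.map (fun U => U i) = uniformLaw :=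
  Measure.infinitePi_map_eval _ i

lemma ae_mem_Ioo : ∀ᵐ U ∂paramLaw, ∀ i, U i ∈ Set.Ioo (0 : ℝ) 1 := by
  rw [ae_all_iff]
  intro i
  have h : ∀ᵐ x ∂uniformLaw, x ∈ Set.Ioo (0 : ℝ) 1 := by
    rw [uniformLaw, ← restrict_Ioo_eq_restrict_Icc]
    exact ae_restrict_mem measurableSet_Ioo
  rw [← map_eval_paramLaw i] at h
  exact ae_of_ae_map (measurable_pi_apply i).aemeasurable h

lemma lintegral_uniformLaw_sq : ∫⁻ x, ENNReal.ofReal (x ^ 2) ∂uniformLaw = ENNReal.ofReal (1 / 3) := by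
  rw [uniformLaw, ← ofReal_integral_eq_lintegral_ofReal]
  · rw [integral_Icc_eq_integral_Ioc, ← intervalIntegral.integral_of_le zero_le_one, integral_pow]
    norm_num
  · exact (continuous_pow 2).continuousOn.integrableOn_Icc
  · exact .of_forall fun x => sq_nonneg x

lemma lintegral_uniformLaw_one_sub_sq :
    ∫⁻ x, ENNReal.ofReal ((1 - x) ^ 2) ∂uniformLaw = ENNReal.ofReal (1 / 3) := by
  rw [uniformLaw, ← ofReal_integral_eq_lintegral_ofReal]
  · rw [integral_Icc_eq_integral_Ioc, ← intervalIntegral.integral_of_le zero_le_one,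
      intervalIntegral.integral_comp_sub_left (fun x : ℝ => x ^ 2) 1, integral_pow]
    norm_num
  · exact (by fun_prop : Continuous fun x : ℝ => (1 - x) ^ 2).continuousOn.integrableOn_Icc
  · exact .of_forall fun x => sq_nonneg _

/-- The second moment of a gap between consecutive values of level `n` is `3 ^ (-n)`. -/
lemma lintegral_gap_sq (n k : ℕ) (hk : k < 2 ^ n) :
    ∫⁻ U, ENNReal.ofReal ((dyadicValue U n (k + 1) - dyadicValue U n k) ^ 2) ∂paramLaw =
      ENNReal.ofReal (1 / 3) ^ n := by
  induction n generalizing k with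
  | zero => simp [dyadicValue]
  | succ n ih =>
    have key : ∀ (F : ℝ → ℝ) (j : ℕ) (hj : j < 2 ^ n), Measurable F →
        ∫⁻ x, ENNReal.ofReal (F x ^ 2) ∂uniformLaw = ENNReal.ofReal (1 / 3) →
        ∫⁻ U, ENNReal.ofReal ((F (U (midIndex n j hj)) *
          (dyadicValue U n (j + 1) - dyadicValue U n j)) ^ 2) ∂paramLaw =
          ENNReal.ofReal (1 / 3) ^ (n + 1) := by
      intro F j hj hF hF3
      have hdisj : Disjoint {midIndex n j hj} (levelLE n) := by
        rw [Set.disjoint_singleton_left]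
        simp [levelLE, midIndex]
      have hm1 : Measurable[sigmaOf {midIndex n j hj}] fun U : DyadicIndex → ℝ =>
          ENNReal.ofReal (F (U (midIndex n j hj)) ^ 2) :=
        ENNReal.measurable_ofReal.comp
          ((hF.comp (measurable_eval_sigmaOf (Set.mem_singleton _))).pow_const 2)
      have hm2 : Measurable[sigmaOf (levelLE n)] fun U : DyadicIndex → ℝ =>
          ENNReal.ofReal ((dyadicValue U n (j + 1) - dyadicValue U n j) ^ 2) :=
        ENNReal.measurable_ofReal.comp
          (((measurable_dyadicValue n (j + 1)).sub (measurable_dyadicValue n j)).pow_const 2)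
      simp only [mul_pow, ENNReal.ofReal_mul (sq_nonneg _)]
      rw [lintegral_mul_eq_lintegral_mul_lintegral_of_independent_measurableSpace (sigmaOf_le _)
        (sigmaOf_le _) (indep_sigmaOf hdisj) hm1 hm2, ih j hj, pow_succ', ← hF3,
        ← map_eval_paramLaw (midIndex n j hj), lintegral_map (by fun_prop) (measurable_pi_apply _)]
    rcases Nat.even_or_odd' k with ⟨j, rfl | rfl⟩
    · have hj : j < 2 ^ n := by rw [pow_succ] at hk; omega
      rw [← key (fun x => x) j hj measurable_id lintegral_uniformLaw_sq]
      refine lintegral_congr fun U => ?_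
      rw [dyadicValue_two_mul, dyadicValue_two_mul_add_one U hj, add_sub_cancel_left]
    · have hj : j < 2 ^ n := by rw [pow_succ] at hk; omega
      rw [← key (fun x => 1 - x) j hj (by fun_prop) lintegral_uniformLaw_one_sub_sq]
      refine lintegral_congr fun U => ?_
      rw [show 2 * j + 1 + 1 = 2 * (j + 1) by ring, dyadicValue_two_mul,
        dyadicValue_two_mul_add_one U hj]
      congr 2
      ring

@[fun_prop]
lemma measurable_dyadicValue' (n k : ℕ) : Measurable fun U => dyadicValue U n k :=
  (measurable_dyadicValue n k).mono (sigmaOf_le _) le_rfl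

lemma ae_tendsto_zero_of_lintegral_le {F : ℕ → (DyadicIndex → ℝ) → ENNReal}
    (hF : ∀ n, Measurable (F n)) (h : ∀ n, ∫⁻ U, F n U ∂paramLaw ≤ 2 ^ n * ENNReal.ofReal (1 / 3) ^ n) :
    ∀ᵐ U ∂paramLaw, Tendsto (fun n => F n U) atTop (𝓝 0) := by
  have hsum : ∫⁻ U, ∑' n, F n U ∂paramLaw ≠ ⊤ := by
    rw [lintegral_tsum fun n => (hF n).aemeasurable]
    refine ne_top_of_le_ne_top ?_ (ENNReal.tsum_le_tsum h)
    simp only [← mul_pow]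
    rw [ENNReal.tsum_geometric]
    have : (2 : ENNReal) * ENNReal.ofReal (1 / 3) < 1 := by
      rw [← ENNReal.ofReal_ofNat, ← ENNReal.ofReal_mul (by norm_num), ENNReal.ofReal_lt_one]
      norm_num
    exact ENNReal.inv_ne_top.2 (tsub_pos_of_lt this).ne'
  filter_upwards [ae_lt_top (Measurable.tsum hF) hsum] with U hU
  exact ENNReal.tendsto_atTop_zero_of_tsum_ne_top hU.ne

lemma ae_mesh : ∀ᵐ U ∂paramLaw, ∀ ε > 0, ∃ n : ℕ, ∀ k < 2 ^ n,
    dyadicValue U n (k + 1) - dyadicValue U n k < ε := by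
  have h := ae_tendsto_zero_of_lintegral_le
    (F := fun n U => ∑ k ∈ Finset.range (2 ^ n),
      ENNReal.ofReal ((dyadicValue U n (k + 1) - dyadicValue U n k) ^ 2)) (fun n => ?_) fun n => ?_
  · filter_upwards [h] with U hU ε hε
    obtain ⟨n, hn⟩ := (hU.eventually_lt_const
      (ENNReal.ofReal_pos.2 (by positivity : 0 < ε ^ 2))).exists
    refine ⟨n, fun k hk => ?_⟩
    have h1 := (Finset.single_le_sum (f := fun k =>
      ENNReal.ofReal ((dyadicValue U n (k + 1) - dyadicValue U n k) ^ 2))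
      (fun _ _ => zero_le) (Finset.mem_range.2 hk)).trans_lt hn
    rw [ENNReal.ofReal_lt_ofReal_iff (by positivity)] at h1
    exact lt_of_pow_lt_pow_left₀ 2 hε.le h1
  · fun_prop
  · rw [lintegral_finsetSum _ fun k _ => by fun_prop,
      Finset.sum_congr rfl fun k hk => lintegral_gap_sq n k (Finset.mem_range.1 hk)]
    simp

lemma ae_spine_sq_le :
    ∀ᵐ U ∂paramLaw, ∀ᶠ m : ℕ in atTop, (2 : ℝ) ^ m * dyadicValue U m 1 ^ 2 ≤ 1 := by
  have h := ae_tendsto_zero_of_lintegral_le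
    (F := fun m U => 2 ^ m * ENNReal.ofReal (dyadicValue U m 1 ^ 2)) (fun m => ?_) fun m => ?_
  · filter_upwards [h] with U hU
    filter_upwards [hU.eventually_le_const one_pos] with m hm
    have e : (2 : ENNReal) ^ m = ENNReal.ofReal (2 ^ m) := by
      rw [ENNReal.ofReal_pow (by norm_num), ENNReal.ofReal_ofNat]
    rwa [e, ← ENNReal.ofReal_mul (by positivity), ENNReal.ofReal_le_one] at hm
  · fun_prop
  · rw [lintegral_const_mul _ (by fun_prop)]
    have := lintegral_gap_sq m 0 (by positivity)
    simp only [zero_add, dyadicValue_zero_right, sub_zero] at this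
    rw [this]

lemma uniformLaw_Icc {a b : ℝ} (ha : 0 ≤ a) (hb : b ≤ 1) :
    uniformLaw (Set.Icc a b) = ENNReal.ofReal (b - a) := by
  rw [uniformLaw, Measure.restrict_apply measurableSet_Icc, Set.inter_eq_left.2
    (Set.Icc_subset_Icc ha hb), Real.volume_Icc]

lemma uniformLaw_Iio_le (a : ℝ) : uniformLaw (Set.Iio a) ≤ ENNReal.ofReal a := by
  rw [uniformLaw, Measure.restrict_apply measurableSet_Iio]
  refine (measure_mono (t := Set.Icc 0 a) fun x hx => ⟨hx.2.1, hx.1.le⟩).trans_eq ?_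
  rw [Real.volume_Icc, sub_zero]

lemma ae_eventually_spine_ge :
    ∀ᵐ U ∂paramLaw, ∀ᶠ m : ℕ in atTop, 1 / ((m : ℝ) + 1) ^ 2 ≤ U (spineIndex m) := by
  have h := ae_eventually_notMem (μ := paramLaw)
    (s := fun m : ℕ => {U : DyadicIndex → ℝ | U (spineIndex m) < 1 / ((m : ℝ) + 1) ^ 2}) ?_
  · filter_upwards [h] with U hU
    exact hU.mono fun m hm => not_lt.1 hm
  · have hs : Summable fun m : ℕ => 1 / ((m : ℝ) + 1) ^ 2 := by
      have := (summable_nat_add_iff 1).2 (Real.summable_one_div_nat_pow.2 (by norm_num : 1 < 2))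
      simpa using this
    refine ne_top_of_le_ne_top hs.tsum_ofReal_ne_top (ENNReal.tsum_le_tsum fun m => ?_)
    refine le_trans (le_of_eq ?_) (uniformLaw_Iio_le _)
    rw [← map_eval_paramLaw (spineIndex m), Measure.map_apply (measurable_pi_apply _)
      measurableSet_Iio]
    rfl

lemma ae_exists_isCrossing : ∀ᵐ U ∂paramLaw, ∀ k, ∃ m, IsCrossing U k m := by
  filter_upwards [ae_spine_sq_le, ae_mem_Ioo] with U hU hU0 k
  classical
  have hex : ∃ m, dyadicValue U m 1 ≤ 2 * scale k := by
    have hs := scale_pos k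
    obtain ⟨m, hm, hm2⟩ := (hU.and ((tendsto_pow_atTop_nhds_zero_of_lt_one
      (r := (1 / 2 : ℝ)) (by norm_num) (by norm_num)).eventually_lt_const
      (by positivity : 0 < (2 * scale k) ^ 2))).exists
    refine ⟨m, ?_⟩
    have h1 : dyadicValue U m 1 ^ 2 ≤ (1 / 2) ^ m := by
      rw [one_div, inv_pow, ← one_div, le_div_iff₀ (by positivity)]
      linarith
    exact (lt_of_pow_lt_pow_left₀ 2 (by positivity) (h1.trans_lt hm2)).le
  exact ⟨Nat.find hex, fun i hi => not_le.1 (Nat.find_min hex hi), Nat.find_spec hex⟩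

/-! ### Favourable crossings occur infinitely often -/

lemma measure_window_eq_lintegral {S : Set DyadicIndex} {i : DyadicIndex} (hi : i ∉ S)
    {Z : (DyadicIndex → ℝ) → ℝ} (hZ : Measurable[sigmaOf S] Z)
    (hZ01 : ∀ U, Z U ∈ Set.Icc (0 : ℝ) 1) {a : ℝ} (ha : a ∈ Set.Icc (0 : ℝ) 1) :
    paramLaw {U | 0 < Z U ∧ a * Z U ≤ U i ∧ U i ≤ Z U} =
      ENNReal.ofReal (1 - a) * ∫⁻ U, ENNReal.ofReal (Z U) ∂paramLaw := by
  have hZ' : Measurable Z := hZ.mono (sigmaOf_le S) le_rfl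
  have hind : IndepFun Z (fun U => U i) paramLaw := by
    have h := indep_sigmaOf (S := S) (T := {i}) (Set.disjoint_singleton_right.2 hi)
    rw [IndepFun_iff_Indep]
    refine indep_of_indep_of_le_left (indep_of_indep_of_le_right h ?_) hZ.comap_le
    exact (measurable_eval_sigmaOf (Set.mem_singleton i)).comap_le
  have hmap := (indepFun_iff_map_prod_eq_prod_map_map hZ'.aemeasurable
    (measurable_pi_apply i).aemeasurable).1 hind
  rw [map_eval_paramLaw] at hmap
  set A : Set (ℝ × ℝ) := {p | 0 < p.1 ∧ a * p.1 ≤ p.2 ∧ p.2 ≤ p.1} with hA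
  have hAm : MeasurableSet A :=
    (measurableSet_lt measurable_const measurable_fst).inter
      ((measurableSet_le (measurable_fst.const_mul a) measurable_snd).inter
        (measurableSet_le measurable_snd measurable_fst))
  have h1 : paramLaw {U | 0 < Z U ∧ a * Z U ≤ U i ∧ U i ≤ Z U} =
      (paramLaw.map fun U => (Z U, U i)) A := by
    rw [Measure.map_apply (hZ'.prodMk (measurable_pi_apply i)) hAm]
    rfl
  have h2 : Measurable fun z => uniformLaw (Prod.mk z ⁻¹' A) := measurable_measure_prodMk_left hAm
  rw [h1, hmap, Measure.prod_apply hAm, lintegral_map h2 hZ',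
    ← lintegral_const_mul _ (by fun_prop)]
  refine lintegral_congr fun U => ?_
  obtain ⟨hz0, hz1⟩ := hZ01 U
  rcases hz0.eq_or_lt with h | h
  · have : Prod.mk (Z U) ⁻¹' A = ∅ := by
      ext x
      simp [hA, ← h]
    rw [this, measure_empty, ← h]
    simp
  · have : Prod.mk (Z U) ⁻¹' A = Set.Icc (a * Z U) (Z U) := by
      ext x
      simp [hA, h]
    rw [this, uniformLaw_Icc (mul_nonneg ha.1 hz0) hz1, ← ENNReal.ofReal_mul (by linarith [ha.2])]
    congr 1
    ring

/-- Given that an independent uniform parameter lies below the threshold `Z`, it is uniformly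
distributed below that threshold. -/
lemma measure_window {S : Set DyadicIndex} {i : DyadicIndex} (hi : i ∉ S)
    {Z : (DyadicIndex → ℝ) → ℝ} (hZ : Measurable[sigmaOf S] Z)
    (hZ01 : ∀ U, Z U ∈ Set.Icc (0 : ℝ) 1) {a : ℝ} (ha : a ∈ Set.Icc (0 : ℝ) 1) :
    paramLaw {U | 0 < Z U ∧ a * Z U ≤ U i ∧ U i ≤ Z U} =
      ENNReal.ofReal (1 - a) * paramLaw {U | 0 < Z U ∧ U i ≤ Z U} := by
  have h0 := measure_window_eq_lintegral hi hZ hZ01 (a := 0) ⟨le_rfl, zero_le_one⟩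
  have h1 : paramLaw {U | 0 < Z U ∧ U i ≤ Z U} =
      paramLaw {U | 0 < Z U ∧ 0 * Z U ≤ U i ∧ U i ≤ Z U} := by
    apply measure_congr
    filter_upwards [ae_mem_Ioo] with U hU
    apply propext
    change (0 < Z U ∧ U i ≤ Z U) ↔ (0 < Z U ∧ 0 * Z U ≤ U i ∧ U i ≤ Z U)
    rw [zero_mul]
    have := (hU i).1.le
    tauto
  rw [h1, h0, measure_window_eq_lintegral hi hZ hZ01 ha]
  simp

/-- The indices of level greater than `n`. -/
def levelGT (n : ℕ) : Set DyadicIndex := {i | n < i.1.1}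

lemma disjoint_levelLE_levelGT (n : ℕ) : Disjoint (levelLE n) (levelGT n) :=
  Set.disjoint_left.2 fun i (h : i.1.1 ≤ n) (h' : n < i.1.1) => absurd h (not_le.2 h')

lemma levelLE_mono : Monotone levelLE := fun _ _ h _ (hi : _ ≤ _) => hi.trans h

lemma measurableSet_nearlyLinear {S : Set DyadicIndex} {m H : ℕ} {δ : ℝ}
    (hS : ∀ i : DyadicIndex, m < i.1.1 → i.1.1 ≤ m + H → i ∈ S) :
    MeasurableSet[sigmaOf S] {U | NearlyLinear U m H δ} := by
  have : {U | NearlyLinear U m H δ} = ⋂ i : DyadicIndex, ⋂ _ : m < i.1.1,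
      ⋂ _ : i.1.1 ≤ m + H, ⋂ _ : i.1.2 < 2 ^ (i.1.1 - m), {U | |U i - 1 / 2| ≤ δ} := by
    ext U
    simp [NearlyLinear]
  rw [this]
  refine MeasurableSet.iInter fun i => MeasurableSet.iInter fun h1 => MeasurableSet.iInter fun h2 =>
    MeasurableSet.iInter fun _ => ?_
  have hm : Measurable[sigmaOf S] fun U : DyadicIndex → ℝ => |U i - 1 / 2| :=
    continuous_abs.measurable.comp ((measurable_eval_sigmaOf (hS i h1 h2)).sub measurable_const)
  exact hm measurableSet_Iic

lemma measurableSet_forall_lt_spine (β : ℝ) (m n : ℕ) (h : m ≤ n + 1) :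
    MeasurableSet[sigmaOf (levelLE n)] {U | ∀ i < m, β < dyadicValue U i 1} := by
  have : {U : DyadicIndex → ℝ | ∀ i < m, β < dyadicValue U i 1} =
      ⋂ i : ℕ, ⋂ _ : i < m, {U | β < dyadicValue U i 1} := by
    ext U
    simp
  rw [this]
  refine MeasurableSet.iInter fun i => MeasurableSet.iInter fun hi => ?_
  exact ((measurable_dyadicValue i 1).mono (sigmaOf_mono (levelLE_mono (by omega))) le_rfl)
    measurableSet_Ioi

lemma measurableSet_isCrossing (k m : ℕ) :
    MeasurableSet[sigmaOf (levelLE m)] {U | IsCrossing U k m} :=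
  (measurableSet_forall_lt_spine _ m m (by omega)).inter
    ((measurable_dyadicValue m 1) measurableSet_Iic)

lemma measurableSet_isFavourable (k m : ℕ) :
    MeasurableSet[sigmaOf (levelLE (m + depth k))] {U | IsFavourable U k m} := by
  have hle : sigmaOf (levelLE m) ≤ sigmaOf (levelLE (m + depth k)) :=
    sigmaOf_mono (levelLE_mono (by omega))
  refine (hle _ (measurableSet_isCrossing k m)).inter (MeasurableSet.inter ?_
    (measurableSet_nearlyLinear fun i _ h => h))
  exact hle _ ((measurable_dyadicValue m 1) measurableSet_Ici)

/-- A lower bound, uniform in the level, for the probability that the homeomorphism is nearly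
linear. -/
lemma measure_nearlyLinear_ge (m H : ℕ) {δ : ℝ} (h0 : 0 ≤ δ) (h1 : δ ≤ 1 / 2) :
    ENNReal.ofReal δ ^ (H * 2 ^ H) ≤ paramLaw {U | NearlyLinear U m H δ} := by
  classical
  set S : Finset DyadicIndex := ((Finset.Ioc m (m + H)) ×ˢ Finset.range (2 ^ H)).subtype
    (fun p : ℕ × ℕ => Odd p.2 ∧ p.2 < 2 ^ p.1) with hS
  have hcard : S.card ≤ H * 2 ^ H := by
    rw [hS, Finset.card_subtype]
    refine (Finset.card_filter_le _ _).trans ?_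
    simp
  have hsub : Set.pi (S : Set DyadicIndex) (fun _ => Set.Icc (1 / 2 - δ) (1 / 2 + δ)) ⊆
      {U | NearlyLinear U m H δ} := by
    intro U hU i hi1 hi2 hi3
    have hiS : i ∈ S := by
      rw [hS, Finset.mem_subtype, Finset.mem_product, Finset.mem_Ioc, Finset.mem_range]
      exact ⟨⟨hi1, hi2⟩, hi3.trans_le (Nat.pow_le_pow_right (by norm_num) (by omega))⟩
    have := hU i hiS
    rw [abs_le]
    constructor <;> linarith [this.1, this.2]
  refine le_trans ?_ (measure_mono hsub)
  rw [paramLaw, Measure.infinitePi_pi _ fun _ _ => measurableSet_Icc, Finset.prod_const,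
    uniformLaw_Icc (by linarith) (by linarith)]
  calc ENNReal.ofReal δ ^ (H * 2 ^ H) ≤ ENNReal.ofReal δ ^ S.card :=
        pow_le_pow_right_of_le_one' (ENNReal.ofReal_le_one.2 (by linarith)) hcard
    _ ≤ _ := by
        gcongr
        linarith

/-- A lower bound for the conditional probability that a crossing is favourable. -/
noncomputable def favourableProb (k : ℕ) : ℝ :=
  (1 / 2) ^ depth k * ((1 / 4) ^ depth k) ^ (depth k * 2 ^ depth k)

lemma favourableProb_mem (k : ℕ) : favourableProb k ∈ Set.Icc (0 : ℝ) 1 := by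
  unfold favourableProb
  refine ⟨by positivity, mul_le_one₀ ?_ (by positivity) ?_⟩
  · exact pow_le_one₀ (by norm_num) (by norm_num)
  · exact pow_le_one₀ (by positivity) (pow_le_one₀ (by norm_num) (by norm_num))

/-- Conditionally on the parameters of level below `m`, a crossing at `2 ^ (-m)` is favourable with
probability at least `favourableProb k`. -/
lemma measure_inter_isFavourable_ge (k l : ℕ) {E : Set (DyadicIndex → ℝ)}
    (hE : MeasurableSet[sigmaOf (levelLE l)] E) :
    ENNReal.ofReal (favourableProb k) * paramLaw (E ∩ {U | IsCrossing U k (l + 1)}) ≤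
      paramLaw (E ∩ {U | IsFavourable U k (l + 1)}) := by
  classical
  set β := 2 * scale k with hβ
  have hβ0 : 0 < β := by have := scale_pos k; positivity
  set H := depth k with hH
  set a : ℝ := 1 - (1 / 2) ^ H with ha
  have ha01 : a ∈ Set.Icc (0 : ℝ) 1 := by
    have h1 : (1 / 2 : ℝ) ^ H ≤ 1 := (half_pow_mem H).2
    have h2 : (0 : ℝ) ≤ (1 / 2) ^ H := (half_pow_mem H).1
    constructor <;> rw [ha] <;> linarith
  set D : Set (DyadicIndex → ℝ) := E ∩ {U | ∀ i < l + 1, β < dyadicValue U i 1} with hD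
  have hDm : MeasurableSet[sigmaOf (levelLE l)] D :=
    hE.inter (measurableSet_forall_lt_spine β (l + 1) l le_rfl)
  set Z : (DyadicIndex → ℝ) → ℝ := D.indicator fun U => β / dyadicValue U l 1 with hZdef
  have hZ : Measurable[sigmaOf (levelLE l)] Z :=
    (measurable_const.div (measurable_dyadicValue l 1)).indicator hDm
  have hpos : ∀ U ∈ D, β < dyadicValue U l 1 := fun U hU => hU.2 l (Nat.lt_succ_self l)
  have hZD : ∀ U ∈ D, Z U = β / dyadicValue U l 1 := fun U hU => Set.indicator_of_mem hU _
  have hZD' : ∀ U ∉ D, Z U = 0 := fun U hU => Set.indicator_of_notMem hU _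
  have hZ01 : ∀ U, Z U ∈ Set.Icc (0 : ℝ) 1 := by
    intro U
    by_cases hU : U ∈ D
    · have h := hpos U hU
      rw [hZD U hU]
      exact ⟨div_nonneg hβ0.le (hβ0.trans h).le, (div_le_one (hβ0.trans h)).2 h.le⟩
    · rw [hZD' U hU]
      exact ⟨le_rfl, zero_le_one⟩
  have hZpos : ∀ U, 0 < Z U ↔ U ∈ D := by
    intro U
    by_cases hU : U ∈ D
    · rw [hZD U hU]
      exact iff_of_true (div_pos hβ0 (hβ0.trans (hpos U hU))) hU
    · rw [hZD' U hU]
      exact iff_of_false (lt_irrefl _) hU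
  have hi : spineIndex l ∉ levelLE l := by simp [spineIndex, levelLE]
  have hcross : E ∩ {U | IsCrossing U k (l + 1)} = {U | 0 < Z U ∧ U (spineIndex l) ≤ Z U} := by
    ext U
    change (U ∈ E ∧ (∀ i < l + 1, β < dyadicValue U i 1) ∧ dyadicValue U (l + 1) 1 ≤ β) ↔
      (0 < Z U ∧ U (spineIndex l) ≤ Z U)
    rw [hZpos, ← and_assoc]
    refine and_congr_right fun hU => ?_
    rw [hZD U hU, spine_succ, le_div_iff₀ (hβ0.trans (hpos U hU))]
  have hfav : {U | 0 < Z U ∧ a * Z U ≤ U (spineIndex l) ∧ U (spineIndex l) ≤ Z U} ∩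
      {U | NearlyLinear U (l + 1) H ((1 / 4) ^ H)} ⊆ E ∩ {U | IsFavourable U k (l + 1)} := by
    rintro U ⟨⟨h1, h2, h3⟩, h4⟩
    have hU := (hZpos U).1 h1
    have hR := hβ0.trans (hpos U hU)
    rw [hZD U hU] at h2 h3
    refine ⟨hU.1, ⟨hU.2, ?_⟩, ?_, h4⟩
    · rw [spine_succ]
      exact (le_div_iff₀ hR).1 h3
    · rw [spine_succ]
      rw [← mul_div_assoc] at h2
      exact (div_le_iff₀ hR).1 h2
  have hsub : sigmaOf (levelLE l) ≤ sigmaOf (levelLE (l + 1)) :=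
    sigmaOf_mono (levelLE_mono (Nat.le_succ l))
  have hwm : MeasurableSet[sigmaOf (levelLE (l + 1))]
      {U | 0 < Z U ∧ a * Z U ≤ U (spineIndex l) ∧ U (spineIndex l) ≤ Z U} := by
    have hZ' : Measurable[sigmaOf (levelLE (l + 1))] Z := hZ.mono hsub le_rfl
    have hX : Measurable[sigmaOf (levelLE (l + 1))] fun U : DyadicIndex → ℝ => U (spineIndex l) :=
      measurable_eval_sigmaOf (by simp [spineIndex, levelLE])
    exact (measurableSet_lt measurable_const hZ').inter
      ((measurableSet_le (measurable_const.mul hZ') hX).inter (measurableSet_le hX hZ'))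
  have hNm : MeasurableSet[sigmaOf (levelGT (l + 1))]
      {U | NearlyLinear U (l + 1) H ((1 / 4) ^ H)} := measurableSet_nearlyLinear fun i h _ => h
  have hindep := Indep_iff _ _ _ |>.1 (indep_sigmaOf (disjoint_levelLE_levelGT (l + 1))) _ _ hwm hNm
  have hH4 : (1 / 4 : ℝ) ^ H ≤ 1 / 2 := by
    have : 1 ≤ H := by rw [hH, depth]; have := one_le_octaves k; omega
    calc (1 / 4 : ℝ) ^ H ≤ (1 / 4) ^ 1 := pow_le_pow_of_le_one (by norm_num) (by norm_num) this
      _ ≤ 1 / 2 := by norm_num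
  refine le_trans ?_ (measure_mono hfav)
  rw [hindep, measure_window hi hZ hZ01 ha01, ← hcross, favourableProb, ← hH,
    ENNReal.ofReal_mul (by positivity), ENNReal.ofReal_pow (p := (1 / 4 : ℝ) ^ H) (by positivity)]
  have e : 1 - a = (1 / 2) ^ H := by rw [ha]; ring
  rw [e]
  calc _ = ENNReal.ofReal ((1 / 2) ^ H) * paramLaw (E ∩ {U | IsCrossing U k (l + 1)}) *
        ENNReal.ofReal ((1 / 4) ^ H) ^ (H * 2 ^ H) := by ring
    _ ≤ _ := by
      gcongr
      exact measure_nearlyLinear_ge (l + 1) H (by positivity) hH4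

lemma IsCrossing.unique {U : DyadicIndex → ℝ} {k m m' : ℕ} (h : IsCrossing U k m)
    (h' : IsCrossing U k m') : m = m' := by
  rcases lt_trichotomy m m' with hlt | heq | hgt
  · exact absurd (h'.1 m hlt) (not_lt.2 h.2)
  · exact heq
  · exact absurd (h.1 m' hgt) (not_lt.2 h'.2)

/-- After a favourable crossing of index `j`, the crossings of larger index are so deep that they do
not interfere with the parameters that the event depends on. -/
lemma IsFavourable.lt_spine {U : DyadicIndex → ℝ} {j k i m : ℕ} (hf : IsFavourable U j i)
    (hjk : j < k) (hk : 3 ≤ k) (hm : m ≤ i + depth j) : 2 * scale k < dyadicValue U m 1 := by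
  have hsk := scale_pos k
  rcases lt_or_ge m i with h | h
  · exact lt_of_le_of_lt (by linarith [scale_anti hjk.le]) (hf.1.1 m h)
  obtain ⟨l, rfl⟩ := Nat.exists_eq_add_of_le h
  have hl : l ≤ depth j := by omega
  obtain ⟨_, hR, hN⟩ := hf
  set H := depth j with hH
  have hH1 : 1 ≤ H := by rw [hH, depth]; have := one_le_octaves j; omega
  have hη : (1 / 2 : ℝ) ^ H ≤ 1 / 2 := by
    calc (1 / 2 : ℝ) ^ H ≤ (1 / 2) ^ 1 := pow_le_pow_of_le_one (by norm_num) (by norm_num) hH1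
      _ = 1 / 2 := pow_one _
  have hδ : (1 / 4 : ℝ) ^ H ≤ 1 / 4 := by
    calc (1 / 4 : ℝ) ^ H ≤ (1 / 4) ^ 1 := pow_le_pow_of_le_one (by norm_num) (by norm_num) hH1
      _ = 1 / 4 := pow_one _
  have hsj := scale_pos j
  have hR0 : scale j ≤ dyadicValue U i 1 := by nlinarith
  have hstep : ∀ l ≤ H, scale j * (1 / 4) ^ l ≤ dyadicValue U (i + l) 1 := by
    intro l
    induction l with
    | zero => intro _; simpa using hR0
    | succ l ih =>
      intro hl
      have h1 := ih (by omega)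
      have h2 := hN (spineIndex (i + l)) (by simp only [spineIndex]; omega)
        (by simp only [spineIndex]; omega) (Nat.one_lt_two_pow (by simp only [spineIndex]; omega))
      have h3 := (abs_le.1 h2).1
      have h4 : 1 / 4 ≤ U (spineIndex (i + l)) := by linarith
      rw [← add_assoc, spine_succ, pow_succ]
      calc scale j * ((1 / 4) ^ l * (1 / 4)) = 1 / 4 * (scale j * (1 / 4) ^ l) := by ring
        _ ≤ _ := mul_le_mul h4 h1 (by positivity) (by linarith)
  refine lt_of_lt_of_le ?_ (hstep l hl)
  have h5 : (1 / 4 : ℝ) ^ H ≤ (1 / 4) ^ l := pow_le_pow_of_le_one (by norm_num) (by norm_num) hl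
  refine lt_of_lt_of_le ?_ (mul_le_mul_of_nonneg_left h5 hsj.le)
  have hgap := scale_gap hjk
  have hM : octaves j ≤ k := (octaves_le j).trans hjk
  have hexp : 7 * octaves j + 2 ≤ k ^ 3 := by
    have h6 : 3 * 3 * k ≤ k * k * k := Nat.mul_le_mul_right _ (Nat.mul_le_mul hk hk)
    calc 7 * octaves j + 2 ≤ 3 * 3 * k := by omega
      _ ≤ k * k * k := h6
      _ = k ^ 3 := by ring
  have hpow : (1 / 4 : ℝ) ^ H = 1 / 2 ^ octaves j * (1 / 2 ^ (7 * octaves j)) := by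
    rw [hH, depth, ← one_div_pow, ← one_div_pow, ← pow_add,
      show (1 / 4 : ℝ) = (1 / 2) ^ 2 by norm_num, ← pow_mul]
    congr 1
    ring
  rw [hpow, ← mul_assoc, mul_one_div, mul_one_div, lt_div_iff₀ (by positivity)]
  refine lt_of_lt_of_le ?_ hgap
  have h7 : (2 : ℝ) ^ (7 * octaves j + 2) ≤ 2 ^ k ^ 3 := pow_le_pow_right₀ (by norm_num) hexp
  rw [pow_add] at h7
  have h8 : (0 : ℝ) < 2 ^ (7 * octaves j) * scale k := by positivity
  have h9 := mul_le_mul_of_nonneg_right h7 hsk.le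
  linarith

/-- No crossing with index in `[k₀, k)` is favourable. -/
def noFavourable (k₀ k : ℕ) : Set (DyadicIndex → ℝ) :=
  {U | ∀ j, k₀ ≤ j → j < k → ∀ m, ¬ IsFavourable U j m}

/-- No crossing with index in `[k₀, k)` is seen to be favourable from the parameters of level at most
`l`. -/
def noFavourableUpTo (k₀ k l : ℕ) : Set (DyadicIndex → ℝ) :=
  {U | ∀ j, k₀ ≤ j → j < k → ∀ m, m + depth j ≤ l → ¬ IsFavourable U j m}

lemma measurableSet_noFavourable (k₀ k : ℕ) : MeasurableSet (noFavourable k₀ k) := by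
  have : noFavourable k₀ k = ⋂ j : ℕ, ⋂ _ : k₀ ≤ j, ⋂ _ : j < k, ⋂ m : ℕ,
      {U | IsFavourable U j m}ᶜ := by
    ext U
    simp [noFavourable]
  rw [this]
  exact MeasurableSet.iInter fun j => MeasurableSet.iInter fun _ => MeasurableSet.iInter fun _ =>
    MeasurableSet.iInter fun m => (sigmaOf_le _ _ (measurableSet_isFavourable j m)).compl

lemma measurableSet_noFavourableUpTo (k₀ k l : ℕ) :
    MeasurableSet[sigmaOf (levelLE l)] (noFavourableUpTo k₀ k l) := by
  have : noFavourableUpTo k₀ k l = ⋂ j : ℕ, ⋂ _ : k₀ ≤ j, ⋂ _ : j < k, ⋂ m : ℕ,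
      ⋂ _ : m + depth j ≤ l, {U | IsFavourable U j m}ᶜ := by
    ext U
    simp [noFavourableUpTo]
  rw [this]
  refine MeasurableSet.iInter fun j => MeasurableSet.iInter fun _ => MeasurableSet.iInter fun _ =>
    MeasurableSet.iInter fun m => MeasurableSet.iInter fun h => ?_
  exact (sigmaOf_mono (levelLE_mono h) _ (measurableSet_isFavourable j m)).compl

lemma noFavourable_inter_isCrossing {k₀ k : ℕ} (hk : 3 ≤ k) (l : ℕ) :
    noFavourable k₀ k ∩ {U | IsCrossing U k (l + 1)} =
      noFavourableUpTo k₀ k l ∩ {U | IsCrossing U k (l + 1)} := by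
  ext U
  refine and_congr_left fun hc => ⟨fun h j h1 h2 m _ => h j h1 h2 m, fun h j h1 h2 m hf => ?_⟩
  refine h j h1 h2 m ?_ hf
  by_contra hlt
  exact absurd (hf.lt_spine h2 hk (by omega : l + 1 ≤ m + depth j)) (not_lt.2 hc.2)

lemma noFavourable_inter_isFavourable {k₀ k : ℕ} (hk : 3 ≤ k) (l : ℕ) :
    noFavourable k₀ k ∩ {U | IsFavourable U k (l + 1)} =
      noFavourableUpTo k₀ k l ∩ {U | IsFavourable U k (l + 1)} := by
  have h : {U | IsFavourable U k (l + 1)} =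
      {U | IsCrossing U k (l + 1)} ∩ {U | IsFavourable U k (l + 1)} :=
    (Set.inter_eq_right.2 fun U hU => hU.1).symm
  rw [h, ← Set.inter_assoc, noFavourable_inter_isCrossing hk, Set.inter_assoc]

lemma not_isCrossing_zero {k : ℕ} (hk : 3 ≤ k) (U : DyadicIndex → ℝ) : ¬ IsCrossing U k 0 := by
  intro h
  have h1 := h.2
  rw [spine_zero] at h1
  have h2 := (scale_le_of_lt (by omega : 0 < k)).trans
    (div_le_div_of_nonneg_left (scale_pos 0).le (by norm_num)
      (le_self_pow₀ (by norm_num : (1 : ℝ) ≤ 2) (by have := one_le_octaves 0; omega)))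
  rw [scale_zero] at h2
  linarith

/-- A crossing of index `k` is favourable with probability at least `favourableProb k`, whatever
happened before. -/
lemma measureReal_noFavourable_succ_le {k₀ k : ℕ} (hk₀ : k₀ ≤ k) (hk : 3 ≤ k) :
    paramLaw.real (noFavourable k₀ (k + 1)) ≤
      (1 - favourableProb k) * paramLaw.real (noFavourable k₀ k) := by
  set B := noFavourable k₀ k with hB
  set G : Set (DyadicIndex → ℝ) := {U | ∃ m, IsFavourable U k m} with hG
  have hGm : MeasurableSet G := by
    have : G = ⋃ m, {U | IsFavourable U k m} := by ext; simp [hG]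
    rw [this]
    exact MeasurableSet.iUnion fun m => sigmaOf_le _ _ (measurableSet_isFavourable k m)
  have hsucc : noFavourable k₀ (k + 1) = B \ G := by
    ext U
    constructor
    · intro h
      exact ⟨fun j h1 h2 => h j h1 (by omega), fun ⟨m, hm⟩ => h k hk₀ (by omega) m hm⟩
    · rintro ⟨h1, h2⟩ j hj hjk m hm
      rcases Nat.lt_succ_iff_lt_or_eq.1 hjk with h | rfl
      · exact h1 j hj h m hm
      · exact h2 ⟨m, hm⟩
  have hmain : ENNReal.ofReal (favourableProb k) * paramLaw B ≤ paramLaw (B ∩ G) := by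
    have h1 : paramLaw B ≤ ∑' l, paramLaw (B ∩ {U | IsCrossing U k (l + 1)}) := by
      have : paramLaw B = paramLaw (⋃ l, B ∩ {U | IsCrossing U k (l + 1)}) := by
        apply measure_congr
        filter_upwards [ae_exists_isCrossing] with U hU
        obtain ⟨m, hm⟩ := hU k
        apply propext
        change U ∈ B ↔ U ∈ ⋃ l, B ∩ {U | IsCrossing U k (l + 1)}
        rw [Set.mem_iUnion]
        refine ⟨fun h => ?_, fun ⟨l, h, _⟩ => h⟩
        obtain ⟨l, rfl⟩ := Nat.exists_eq_succ_of_ne_zero fun h0 : m = 0 =>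
          not_isCrossing_zero hk U (h0 ▸ hm)
        exact ⟨l, h, hm⟩
      rw [this]
      exact measure_iUnion_le _
    calc ENNReal.ofReal (favourableProb k) * paramLaw B
        ≤ ENNReal.ofReal (favourableProb k) *
            ∑' l, paramLaw (B ∩ {U | IsCrossing U k (l + 1)}) := by gcongr
      _ = ∑' l, ENNReal.ofReal (favourableProb k) *
            paramLaw (B ∩ {U | IsCrossing U k (l + 1)}) := ENNReal.tsum_mul_left.symm
      _ ≤ ∑' l, paramLaw (B ∩ {U | IsFavourable U k (l + 1)}) := by
          refine ENNReal.tsum_le_tsum fun l => ?_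
          rw [hB, noFavourable_inter_isCrossing hk, noFavourable_inter_isFavourable hk]
          exact measure_inter_isFavourable_ge k l (measurableSet_noFavourableUpTo k₀ k l)
      _ = paramLaw (⋃ l, B ∩ {U | IsFavourable U k (l + 1)}) := by
          rw [measure_iUnion]
          · intro l l' hll'
            refine Set.disjoint_left.2 fun U h h' => hll' ?_
            have := h.2.1.unique h'.2.1
            omega
          · exact fun l => (measurableSet_noFavourable k₀ k).inter
              (sigmaOf_le _ _ (measurableSet_isFavourable k (l + 1)))
      _ ≤ paramLaw (B ∩ G) := by
          refine measure_mono (Set.iUnion_subset fun l => ?_)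
          exact Set.inter_subset_inter_right _ fun U hU => ⟨l + 1, hU⟩
  have hreal : favourableProb k * paramLaw.real B ≤ paramLaw.real (B ∩ G) := by
    have := ENNReal.toReal_mono (measure_ne_top _ _) hmain
    rwa [ENNReal.toReal_mul, ENNReal.toReal_ofReal (favourableProb_mem k).1] at this
  have hsplit := measureReal_inter_add_sdiff (μ := paramLaw) (s := B) hGm
  rw [hsucc]
  linarith

lemma eventually_one_div_le_favourableProb :
    ∀ᶠ k : ℕ in atTop, 1 / (k : ℝ) ≤ favourableProb k := by
  filter_upwards [tendsto_octaves.eventually_ge_atTop 5, eventually_ge_atTop 2] with k hk hk2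
  set M := octaves k with hM
  have hlog0 : Nat.log 2 k ≠ 0 := (Nat.log_pos (by norm_num) hk2).ne'
  have h1 : 16 * (M - 1) ≤ Nat.log 2 (Nat.log 2 k) := by
    rw [hM, octaves]
    omega
  have h2 : 2 ^ (16 * (M - 1)) ≤ Nat.log 2 k := Nat.pow_le_of_le_log hlog0 h1
  have hdep : depth k = 4 * M := rfl
  set H := depth k with hH
  have h3 : H + 2 * H * (H * 2 ^ H) ≤ Nat.log 2 k := by
    have hlt : H ≤ 2 ^ H := Nat.lt_two_pow_self.le
    have h4 : H * H ≤ 2 ^ H * 2 ^ H := Nat.mul_le_mul hlt hlt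
    have h5 : 1 ≤ 2 ^ H := Nat.one_le_two_pow
    have h6 : 2 ^ H ≤ 2 ^ H * 2 ^ H * 2 ^ H := by nlinarith [Nat.mul_le_mul h5 h5]
    calc H + 2 * H * (H * 2 ^ H) = H + 2 * (H * H * 2 ^ H) := by ring
      _ ≤ 2 ^ H + 2 * (2 ^ H * 2 ^ H * 2 ^ H) := by gcongr
      _ ≤ 2 ^ 2 * (2 ^ H * 2 ^ H * 2 ^ H) := by omega
      _ = 2 ^ (2 + (H + H + H)) := by rw [pow_add, pow_add, pow_add]
      _ ≤ 2 ^ (16 * (M - 1)) := Nat.pow_le_pow_right (by norm_num) (by omega)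
      _ ≤ _ := h2
  have h4 : 2 ^ (H + 2 * H * (H * 2 ^ H)) ≤ k := Nat.pow_le_of_le_log (by omega) h3
  have h5 : favourableProb k = 1 / 2 ^ (H + 2 * H * (H * 2 ^ H)) := by
    rw [favourableProb, ← hH, show (1 / 4 : ℝ) = (1 / 2) ^ 2 by norm_num, ← pow_mul, ← pow_mul,
      ← pow_add, one_div_pow, mul_assoc]
  rw [h5]
  apply one_div_le_one_div_of_le (by positivity)
  exact_mod_cast h4

/-- Second Borel–Cantelli argument: almost surely there are infinitely many favourable crossings. -/
theorem ae_frequently_isFavourable :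
    ∀ᵐ U ∂paramLaw, ∃ᶠ k in atTop, ∃ m, IsFavourable U k m := by
  obtain ⟨k₁, hk₁⟩ := eventually_atTop.1 eventually_one_div_le_favourableProb
  have hzero : ∀ k₀, k₁ ≤ k₀ → 3 ≤ k₀ →
      paramLaw {U | ∀ j, k₀ ≤ j → ∀ m, ¬ IsFavourable U j m} = 0 := by
    intro k₀ h1 h3
    set x : ℕ → ℝ := fun k => paramLaw.real (noFavourable k₀ k) with hx
    have hx0 : ∀ k, 0 ≤ x k := fun k => measureReal_nonneg
    have hdec : ∀ k, k₀ ≤ k → ((k : ℝ) - 1) * x k ≤ ((k₀ : ℝ) - 1) * x k₀ := by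
      intro k hk
      induction k, hk using Nat.le_induction with
      | base => exact le_rfl
      | succ k hk ih =>
        refine le_trans ?_ ih
        have hkpos : (0 : ℝ) < k := by exact_mod_cast (by omega : 0 < k)
        have h4 := measureReal_noFavourable_succ_le hk (h3.trans hk)
        have h5 : x (k + 1) ≤ (1 - 1 / k) * x k := by
          refine h4.trans (mul_le_mul_of_nonneg_right ?_ (hx0 k))
          linarith [hk₁ k (h1.trans hk)]
        push_cast
        calc ((k : ℝ) + 1 - 1) * x (k + 1) = k * x (k + 1) := by ring
          _ ≤ k * ((1 - 1 / k) * x k) := mul_le_mul_of_nonneg_left h5 hkpos.le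
          _ = ((k : ℝ) - 1) * x k := by field_simp
    have hlim : Tendsto (fun k : ℕ => ((k₀ : ℝ) - 1) * x k₀ / ((k : ℝ) - 1)) atTop (𝓝 0) :=
      (tendsto_atTop_add_const_right _ (-1 : ℝ) tendsto_natCast_atTop_atTop).const_div_atTop _
    have hle : ∀ k, paramLaw.real {U | ∀ j, k₀ ≤ j → ∀ m, ¬ IsFavourable U j m} ≤ x k := fun k =>
      measureReal_mono fun U hU j hj _ => hU j hj
    have : paramLaw.real {U | ∀ j, k₀ ≤ j → ∀ m, ¬ IsFavourable U j m} ≤ 0 := by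
      refine ge_of_tendsto hlim ?_
      filter_upwards [eventually_ge_atTop k₀] with k hk
      have hkpos : (0 : ℝ) < (k : ℝ) - 1 := by
        have : ((3 : ℕ) : ℝ) ≤ k := by exact_mod_cast h3.trans hk
        push_cast at this
        linarith
      refine (hle k).trans ?_
      rw [le_div_iff₀ hkpos, mul_comm]
      exact hdec k hk
    exact (measureReal_eq_zero_iff).1 (le_antisymm this measureReal_nonneg)
  have hall : ∀ᵐ U ∂paramLaw, ∀ k₀, k₁ ≤ k₀ → 3 ≤ k₀ →
      ¬ ∀ j, k₀ ≤ j → ∀ m, ¬ IsFavourable U j m := by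
    rw [ae_all_iff]
    intro k₀
    by_cases h : k₁ ≤ k₀ ∧ 3 ≤ k₀
    · have h0 := hzero k₀ h.1 h.2
      rw [← compl_mem_ae_iff] at h0
      filter_upwards [h0] with U hU _ _
      exact hU
    · exact .of_forall fun U h1 h2 => absurd ⟨h1, h2⟩ h
  filter_upwards [hall] with U hU
  rw [frequently_atTop]
  intro a
  have := hU (max a (max k₁ 3)) (by simp) (by simp)
  push Not at this
  obtain ⟨j, hj, hm⟩ := this
  exact ⟨j, (le_max_left _ _).trans hj, hm⟩

/-! ### Divergence -/

theorem ae_exists_homeo_and_diverges :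
    ∀ᵐ U ∂paramLaw, ∃ φ : unitInterval ≃ₜ unitInterval, ExtendsDyadic U φ ∧
      ¬ ∃ L : ℂ, Tendsto (fun n : ℕ => fourierPartialSum (compHomeo circleBump φ) n 0)
        atTop (𝓝 L) := by
  filter_upwards [ae_mem_Ioo, ae_mesh, ae_spine_sq_le, ae_eventually_spine_ge,
    ae_exists_isCrossing, ae_frequently_isFavourable] with U hU hmesh hsq hratio hcross hfav
  obtain ⟨φ, hφ, hmono⟩ := exists_extendsDyadic hU hmesh
  refine ⟨φ, hφ, ?_⟩
  rintro ⟨L, hL⟩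
  refine not_tendsto_integral_bumpSum (isHomeoOf_projIcc hU hφ hmono)
    (eventually_spine_decay hU hsq hratio) hcross hfav ⟨L.re, ?_⟩
  simp only [← re_fourierPartialSum]
  exact (Complex.continuous_re.tendsto L).comp hL

theorem theorem2 :
    ∃ f : C(UnitAddCircle, ℝ),
      ((fun δ : ℝ => |f (δ : UnitAddCircle) - f 0|) =O[𝓝[≠] 0]
        fun δ : ℝ => (Real.log (Real.log (Real.log (1 / |δ|))))⁻¹) ∧
      ((fun δ : ℝ => modulusOfContinuity f δ) =O[𝓝[>] 0]
        fun δ : ℝ => (Real.log (Real.log (Real.log (1 / δ))))⁻¹) ∧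
      ∀ (Ω : Type*) [MeasurableSpace Ω] (P : Measure Ω) [IsProbabilityMeasure P]
        (X : DyadicIndex → Ω → ℝ),
        (∀ i, HasLaw (X i) (volume.restrict (Set.Icc (0 : ℝ) 1)) P) →
        iIndepFun X P →
        ∀ᵐ ω ∂P, ∃ φ : unitInterval ≃ₜ unitInterval,
          ExtendsDyadic (fun i => X i ω) φ ∧
          ¬ ∃ L : ℂ, Tendsto (fun n : ℕ => fourierPartialSum (compHomeo f φ) n 0)
            atTop (𝓝 L) := by
  refine ⟨circleBump, abs_circleBump_sub_zero_isBigO, modulusOfContinuity_circleBump_isBigO, ?_⟩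
  intro Ω _ P _ X hX hind
  have hmeas : ∀ i, AEMeasurable (X i) P := fun i => (hX i).aemeasurable
  have hlaw : P.map (fun ω i => X i ω) = paramLaw := by
    rw [(iIndepFun_iff_map_fun_eq_infinitePi_map₀' hmeas).1 hind, paramLaw]
    congr 1
    funext i
    exact (hX i).map_eq
  have h := ae_exists_homeo_and_diverges
  rw [← hlaw] at h
  exact ae_of_ae_map (aemeasurable_pi_iff.2 hmeas) h
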